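/- Let $n\ge 1$ be an integer, set $c(n):=\int_0^\infty (e^{\xi}-1)^{-\frac{1}{n+1}}\,d\xi$, and let $\varphi:(0,1)\to(0,\infty)$ be the smooth function determined by $$\int_0^{\varphi(s)}(e^{\xi}-1)^{-\frac1{n+1}}\,d\xi=c(n)\,s .$$ (This is the limit of $\psi_T((1-s)T)-\psi_T(T)$, where $\psi_T$ is the radial potential, as a function of $t=\log h$, of the $n$-dimensional Kähler–Einstein horn metrics $i\partial\overline\partial\psi_T$.) Let $L_\infty$ be the limit neck operator, i.e. the Laplacian of $\varphi$ on radial functions minus the identity: $$L_\infty u=\frac{u''}{\varphi''}+(n-1)\frac{u'}{\varphi'}-u\qquad\text{on }(0,1).$$ Solutions are understood to be twice continuously differentiable functions on $(0,1)$. There is a unique solution $\hat u$ of $L_\infty\hat u=0$ on $(0,1)$ such that $\hat u(s)\to1$ as $s\to0^+$ and $\hat u(s)\to0$ as $s\to1^-$. It has the following properties. (1) $\hat u$ is strictly decreasing on $(0,1)$. (2) $\hat u(1-\eta)=O(\eta^{n+1})$ as $\eta\to0^+$. (3) There are constants $C_1,C_2>0$ such that $\hat u(s)=1-C_1s^{\frac1n}+C_2s^{\frac{n+1}n}+R(s)$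 with $|R(s)|+s|R'(s)|+s^2|R''(s)|=O(s^{\frac{n+2}n})$ as $s\to0^+$. (4) If $L_\infty u=0$ on $(0,1)$ and $|u(s)|\le Cs^{-\delta}$ on $(0,1)$ for some $C$ and some $\delta\in(0,1)$, then $u$ is a scalar multiple of $\hat u$. -/

import Mathlib

open Set Filter Topology MeasureTheory Asymptotics

noncomputable section

/-- The function `y ↦ ∫₀^y (e^ξ - 1)^(-1/(n+1)) dξ`, for `y ≥ 0`. -/
def hornTime (n : ℕ) (y : ℝ) : ℝ :=
  ∫ ξ in (0 : ℝ)..y, (Real.exp ξ - 1) ^ (-(1 / ((n : ℝ) + 1)))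

/-- The constant `c(n) = ∫₀^∞ (e^ξ - 1)^(-1/(n+1)) dξ`. -/
def hornConst (n : ℕ) : ℝ :=
  ∫ ξ in Ioi (0 : ℝ), (Real.exp ξ - 1) ^ (-(1 / ((n : ℝ) + 1)))

/-- The limit neck potential `φ` on `(0,1)`: the inverse function of
`y ↦ c(n)⁻¹ ∫₀^y (e^ξ - 1)^(-1/(n+1)) dξ`. It is the limit of `ψ_T((1-s)T) - ψ_T(T)` for the
horn potentials `ψ_T` (see `IsHornPotential.tendsto_radialLaplacian`). -/
def neckPotential (n : ℕ) (s : ℝ) : ℝ :=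
  Function.invFunOn (hornTime n) (Ici 0) (hornConst n * s)

/-- The Laplacian of the `n`-dimensional radial Kähler metric `i∂∂̄φ` (over a flat base of complex
dimension `n - 1`), restricted to radial functions: `u''/φ'' + (n-1) u'/φ'`. -/
def radialLaplacian (n : ℕ) (φ u : ℝ → ℝ) (s : ℝ) : ℝ :=
  deriv (deriv u) s / deriv (deriv φ) s + ((n : ℝ) - 1) * (deriv u s / deriv φ s)

/-- The limit neck operator `L_∞ = Δ_φ - Id` on functions of `s ∈ (0,1)`. -/
def neckOperator (n : ℕ) (u : ℝ → ℝ) (s : ℝ) : ℝ :=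
  radialLaplacian n (neckPotential n) u s - u s

/-- `u` is a (classical) solution of `L_∞ u = 0` on `(0,1)`. -/
def IsNeckSolution (n : ℕ) (u : ℝ → ℝ) : Prop :=
  ContDiffOn ℝ 2 u (Ioo 0 1) ∧ ∀ s ∈ Ioo (0 : ℝ) 1, neckOperator n u s = 0

/-- The horn potential `ψ_T` on `[T, τ]` with parameter `b < 0`: it solves the radial
Kähler-Einstein equation `(ψ')^(n+1)/(n+1) = e^(ψ+a) + b`, `ψ' > 0`, and satisfies
`e^(ψ(T)+a) + b = 0` and `ψ(τ) = ψ_cusp(τ)`. -/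
structure IsHornPotential (n : ℕ) (a b T τ : ℝ) (ψ : ℝ → ℝ) : Prop where
  b_neg : b < 0
  T_lt : T < τ
  τ_neg : τ < 0
  cont : ContinuousOn ψ (Icc T τ)
  diff : ∀ t ∈ Ioo T τ, DifferentiableAt ℝ ψ t
  deriv_pos : ∀ t ∈ Ioo T τ, 0 < deriv ψ t
  ode : ∀ t ∈ Ioo T τ, deriv ψ t ^ (n + 1) / ((n : ℝ) + 1) = Real.exp (ψ t + a) + b
  left : Real.exp (ψ T + a) + b = 0
  right : ψ τ = -((n : ℝ) + 1) * Real.log (-τ) + n * Real.log ((n : ℝ) + 1) - a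

section Facts

variable {n : ℕ}

theorem hornExp_pos : 0 < 1 / ((n : ℝ) + 1) := by positivity

theorem hornExp_lt_one (hn : 1 ≤ n) : 1 / ((n : ℝ) + 1) < 1 := by
  have : (1 : ℝ) ≤ n := by exact_mod_cast hn
  rw [div_lt_one (by positivity)]; linarith

theorem hornIntegrand_pos {ξ : ℝ} (h : 0 < ξ) :
    0 < (Real.exp ξ - 1) ^ (-(1 / ((n : ℝ) + 1))) :=
  Real.rpow_pos_of_pos (by linarith [Real.add_one_lt_exp h.ne']) _

theorem hornIntegrand_continuousAt {ξ : ℝ} (h : 0 < ξ) :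
    ContinuousAt (fun ξ : ℝ => (Real.exp ξ - 1) ^ (-(1 / ((n : ℝ) + 1)))) ξ := by
  refine ContinuousAt.rpow_const (by fun_prop) (Or.inl ?_)
  linarith [Real.add_one_lt_exp h.ne']

theorem hornIntegrand_aesm (a : ℝ) (ha : 0 ≤ a) :
    AEStronglyMeasurable (fun ξ : ℝ => (Real.exp ξ - 1) ^ (-(1 / ((n : ℝ) + 1))))
      (volume.restrict (Ioi a)) := by
  refine ContinuousOn.aestronglyMeasurable ?_ measurableSet_Ioi
  intro ξ hξ
  exact (hornIntegrand_continuousAt (lt_of_le_of_lt ha hξ)).continuousWithinAt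

theorem hornIntegrand_integrable (hn : 1 ≤ n) :
    IntegrableOn (fun ξ : ℝ => (Real.exp ξ - 1) ^ (-(1 / ((n : ℝ) + 1)))) (Ioi 0) := by
  have h1 := hornExp_lt_one hn
  have h0 : 0 < 1 / ((n : ℝ) + 1) := hornExp_pos
  set α := 1 / ((n : ℝ) + 1) with hα
  rw [← Ioc_union_Ioi_eq_Ioi (zero_le_one (α := ℝ))]
  refine IntegrableOn.union ?_ ?_
  · have hi : IntegrableOn (fun ξ : ℝ => ξ ^ (-α)) (Ioc 0 1) :=
      (intervalIntegrable_iff_integrableOn_Ioc_of_le zero_le_one).1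
        (intervalIntegral.intervalIntegrable_rpow' (by linarith))
    refine Integrable.mono' hi
      ((hornIntegrand_aesm (n := n) 0 le_rfl).mono_measure
        (Measure.restrict_mono Ioc_subset_Ioi_self le_rfl)) ?_
    refine (ae_restrict_iff' measurableSet_Ioc).2 (Eventually.of_forall fun ξ hξ => ?_)
    rw [Real.norm_of_nonneg (hornIntegrand_pos hξ.1).le]
    exact Real.rpow_le_rpow_of_nonpos hξ.1 (by linarith [Real.add_one_le_exp ξ]) (by linarith)
  · have hi : IntegrableOn (fun ξ : ℝ => (1 / 2 : ℝ) ^ (-α) * Real.exp (-α * ξ)) (Ioi 1) :=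
      (exp_neg_integrableOn_Ioi 1 h0).const_mul _
    refine Integrable.mono' hi (hornIntegrand_aesm (n := n) 1 zero_le_one) ?_
    refine (ae_restrict_iff' measurableSet_Ioi).2 (Eventually.of_forall fun ξ hξ => ?_)
    have hξ' : (1 : ℝ) < ξ := hξ
    rw [Real.norm_of_nonneg (hornIntegrand_pos (by linarith)).le]
    have : (1 / 2 : ℝ) ^ (-α) * Real.exp (-α * ξ) = (1 / 2 * Real.exp ξ) ^ (-α) := by
      rw [Real.mul_rpow (by norm_num) (Real.exp_pos _).le, ← Real.exp_mul]
      ring_nf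
    rw [this]
    refine Real.rpow_le_rpow_of_nonpos (by positivity) ?_ (by linarith)
    linarith [Real.add_one_le_exp ξ]

theorem hornIntegrand_intervalIntegrable (hn : 1 ≤ n) {x y : ℝ} (hx : 0 ≤ x) (hy : 0 ≤ y) :
    IntervalIntegrable (fun ξ : ℝ => (Real.exp ξ - 1) ^ (-(1 / ((n : ℝ) + 1)))) volume x y := by
  rw [intervalIntegrable_iff]
  refine (hornIntegrand_integrable hn).mono_set ?_
  intro z hz
  exact lt_of_le_of_lt (le_min hx hy) hz.1

theorem hornTime_strictMonoOn (hn : 1 ≤ n) : StrictMonoOn (hornTime n) (Ici 0) := by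
  intro x hx y hy hxy
  have hx' : (0 : ℝ) ≤ x := hx
  have hy' : (0 : ℝ) ≤ y := hy
  have h := intervalIntegral.integral_interval_sub_left
    (hornIntegrand_intervalIntegrable hn le_rfl hy')
    (hornIntegrand_intervalIntegrable hn le_rfl hx')
  have hp := intervalIntegral.intervalIntegral_pos_of_pos_on
    (hornIntegrand_intervalIntegrable hn hx' hy')
    (fun ξ hξ => hornIntegrand_pos (n := n) (lt_of_le_of_lt hx' hξ.1)) hxy
  unfold hornTime
  linarith

theorem hornTime_zero : hornTime n 0 = 0 := by simp [hornTime]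

theorem hornTime_continuousOn (hn : 1 ≤ n) (y : ℝ) :
    ContinuousOn (hornTime n) (Icc 0 y) := by
  rcases lt_or_ge y 0 with hy | hy
  · rw [Icc_eq_empty (not_le.2 hy)]; exact continuousOn_empty _
  · have := intervalIntegral.continuousOn_primitive_interval'
      (hornIntegrand_intervalIntegrable (n := n) hn le_rfl hy) left_mem_uIcc
    rwa [uIcc_of_le hy] at this

theorem hornTime_hasDerivAt (hn : 1 ≤ n) {y : ℝ} (hy : 0 < y) :
    HasDerivAt (hornTime n) ((Real.exp y - 1) ^ (-(1 / ((n : ℝ) + 1)))) y := by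
  refine intervalIntegral.integral_hasDerivAt_right
    (hornIntegrand_intervalIntegrable hn le_rfl hy.le) ?_ (hornIntegrand_continuousAt hy)
  exact ContinuousOn.stronglyMeasurableAtFilter isOpen_Ioi
    (fun ξ hξ => (hornIntegrand_continuousAt hξ).continuousWithinAt) y hy

theorem hornTime_tendsto (hn : 1 ≤ n) : Tendsto (hornTime n) atTop (𝓝 (hornConst n)) :=
  intervalIntegral_tendsto_integral_Ioi 0 (hornIntegrand_integrable hn) tendsto_id

theorem hornTime_lt (hn : 1 ≤ n) {y : ℝ} (hy : 0 ≤ y) : hornTime n y < hornConst n := by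
  refine lt_of_lt_of_le (hornTime_strictMonoOn hn hy (show (0 : ℝ) ≤ y + 1 by linarith)
    (by linarith)) ?_
  refine ge_of_tendsto (hornTime_tendsto hn) ?_
  filter_upwards [eventually_ge_atTop (y + 1)] with z hz
  exact (hornTime_strictMonoOn hn).monotoneOn (show (0 : ℝ) ≤ y + 1 by linarith)
    (show (0 : ℝ) ≤ z by linarith) hz

theorem hornConst_pos (hn : 1 ≤ n) : 0 < hornConst n := by
  have := hornTime_lt hn (le_refl (0 : ℝ))
  rwa [hornTime_zero] at this

theorem hornTime_surj (hn : 1 ≤ n) {x : ℝ} (h0 : 0 ≤ x) (h1 : x < hornConst n) :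
    ∃ y ∈ Ici (0 : ℝ), hornTime n y = x := by
  obtain ⟨Y, hY, hY0⟩ := (((hornTime_tendsto hn).eventually_const_lt h1).and
    (eventually_ge_atTop 0)).exists
  obtain ⟨y, hy, hyx⟩ := intermediate_value_Icc hY0 (hornTime_continuousOn hn Y)
    (show x ∈ Icc (hornTime n 0) (hornTime n Y) from ⟨by rwa [hornTime_zero], hY.le⟩)
  exact ⟨y, hy.1, hyx⟩

/-- On `(0,1)` the neck potential is positive and is the asserted inverse function. -/
theorem neckPotential_spec (hn : 1 ≤ n) {s : ℝ} (hs : s ∈ Ioo (0 : ℝ) 1) :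
    0 < neckPotential n s ∧ hornTime n (neckPotential n s) = hornConst n * s := by
  have hc := hornConst_pos hn
  have hex := hornTime_surj hn (mul_pos hc hs.1).le (mul_lt_of_lt_one_right hc hs.2)
  have h1 : neckPotential n s ∈ Ici (0 : ℝ) := Function.invFunOn_mem hex
  have h2 : hornTime n (neckPotential n s) = hornConst n * s := Function.invFunOn_eq hex
  refine ⟨lt_of_le_of_ne h1 fun h => ?_, h2⟩
  rw [← h, hornTime_zero] at h2
  exact (mul_pos hc hs.1).ne h2

theorem hornTime_tendsto_inverse (hn : 1 ≤ n) {ι : Type*} {l : Filter ι} {y : ι → ℝ} {y₀ : ℝ}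
    (hy₀ : 0 < y₀) (hy : ∀ᶠ i in l, 0 ≤ y i)
    (h : Tendsto (fun i => hornTime n (y i)) l (𝓝 (hornTime n y₀))) : Tendsto y l (𝓝 y₀) := by
  have hm := hornTime_strictMonoOn (n := n) hn
  rw [tendsto_order]
  constructor
  · intro a ha
    have h1 : hornTime n (max a 0) < hornTime n y₀ :=
      hm (le_max_right a 0) hy₀.le (max_lt ha hy₀)
    filter_upwards [hy, h.eventually_const_lt h1] with i hi hi'
    exact lt_of_le_of_lt (le_max_left a 0) ((hm.lt_iff_lt (le_max_right a 0) hi).1 hi')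
  · intro a ha
    have h1 : hornTime n y₀ < hornTime n a := hm hy₀.le (hy₀.trans ha).le ha
    filter_upwards [hy, h.eventually_lt_const h1] with i hi hi'
    exact (hm.lt_iff_lt hi (hy₀.trans ha).le).1 hi'

/-- The neck potential satisfies `φ' = c(n) (e^φ - 1)^(1/(n+1))`. -/
theorem neckPotential_hasDerivAt (hn : 1 ≤ n) {s : ℝ} (hs : s ∈ Ioo (0 : ℝ) 1) :
    HasDerivAt (neckPotential n)
      (hornConst n * (Real.exp (neckPotential n s) - 1) ^ (1 / ((n : ℝ) + 1))) s := by
  have hc := hornConst_pos hn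
  obtain ⟨hp, hs'⟩ := neckPotential_spec hn hs
  have hn1 : ∀ᶠ r in 𝓝 s, r ∈ Ioo (0 : ℝ) 1 := isOpen_Ioo.mem_nhds hs
  have hcont : ContinuousAt (neckPotential n) s := by
    refine hornTime_tendsto_inverse hn hp
      (hn1.mono fun r hr => (neckPotential_spec hn hr).1.le) ?_
    rw [hs']
    refine Tendsto.congr' (hn1.mono fun r hr => ((neckPotential_spec hn hr).2).symm) ?_
    exact (continuous_const.mul continuous_id).tendsto s
  have hd := (hornTime_hasDerivAt hn hp).const_mul (hornConst n)⁻¹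
  have hpos := hornIntegrand_pos (n := n) hp
  have hinv := hd.of_local_left_inverse hcont (mul_pos (inv_pos.2 hc) hpos).ne'
    (hn1.mono fun r hr => by rw [(neckPotential_spec hn hr).2]; field_simp)
  refine hinv.congr_deriv ?_
  rw [mul_inv, inv_inv, Real.rpow_neg (by linarith [Real.add_one_le_exp (neckPotential n s)]),
    inv_inv]

/-- The first two derivatives of a solution of `f' = k (e^(f-m) - 1)^(1/(n+1))`. -/
theorem deriv_deriv_of_ode {f : ℝ → ℝ} {k m : ℝ} {U : Set ℝ} (hU : IsOpen U)
    (hpos : ∀ t ∈ U, m < f t)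
    (hf : ∀ t ∈ U, HasDerivAt f (k * (Real.exp (f t - m) - 1) ^ (1 / ((n : ℝ) + 1))) t)
    {t : ℝ} (ht : t ∈ U) :
    deriv (deriv f) t = k ^ 2 * (1 / ((n : ℝ) + 1) * Real.exp (f t - m) *
      (Real.exp (f t - m) - 1) ^ (2 * (1 / ((n : ℝ) + 1)) - 1)) := by
  have hE : 0 < Real.exp (f t - m) - 1 := by
    have := Real.add_one_lt_exp (sub_pos.2 (hpos t ht)).ne'
    linarith [hpos t ht]
  have h1 : deriv f =ᶠ[𝓝 t] fun r => k * (Real.exp (f r - m) - 1) ^ (1 / ((n : ℝ) + 1)) :=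
    Filter.mem_of_superset (hU.mem_nhds ht) fun r hr => (hf r hr).deriv
  rw [h1.deriv_eq]
  have h2 := (((((hf t ht).sub_const m).exp.sub_const 1).rpow_const
    (p := 1 / ((n : ℝ) + 1)) (Or.inl hE.ne')).const_mul k)
  rw [h2.deriv]
  have h3 : (Real.exp (f t - m) - 1) ^ (2 * (1 / ((n : ℝ) + 1)) - 1) =
      (Real.exp (f t - m) - 1) ^ (1 / ((n : ℝ) + 1)) *
      (Real.exp (f t - m) - 1) ^ (1 / ((n : ℝ) + 1) - 1) := by
    rw [← Real.rpow_add hE]; ring_nf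
  rw [h3]
  ring

namespace IsHornPotential

variable {a b T τ : ℝ} {ψ : ℝ → ℝ}

theorem strictMonoOn (h : IsHornPotential n a b T τ ψ) : StrictMonoOn ψ (Icc T τ) :=
  strictMonoOn_of_deriv_pos (convex_Icc T τ) h.cont (by
    rw [interior_Icc]; exact h.deriv_pos)

theorem hasDerivAt (h : IsHornPotential n a b T τ ψ) {t : ℝ} (ht : t ∈ Ioo T τ) :
    HasDerivAt ψ ((((n : ℝ) + 1) * -b) ^ (1 / ((n : ℝ) + 1)) *
      (Real.exp (ψ t - ψ T) - 1) ^ (1 / ((n : ℝ) + 1))) t := by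
  have hn0 : (0 : ℝ) < (n : ℝ) + 1 := by positivity
  have hb : 0 < -b := neg_pos.2 h.b_neg
  have hlt : ψ T < ψ t := h.strictMonoOn ⟨le_rfl, h.T_lt.le⟩ ⟨ht.1.le, ht.2.le⟩ ht.1
  have hE : 0 < Real.exp (ψ t - ψ T) - 1 := by
    have := Real.add_one_lt_exp (sub_pos.2 hlt).ne'
    linarith
  have hd := (h.diff t ht).hasDerivAt
  refine hd.congr_deriv ?_
  have h1 : deriv ψ t ^ (n + 1) = (((n : ℝ) + 1) * -b) * (Real.exp (ψ t - ψ T) - 1) := by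
    have h2 := h.ode t ht
    have h3 : Real.exp (ψ t + a) = Real.exp (ψ t - ψ T) * Real.exp (ψ T + a) := by
      rw [← Real.exp_add]; ring_nf
    have h4 : Real.exp (ψ T + a) = -b := by linarith [h.left]
    rw [h3, h4, div_eq_iff hn0.ne'] at h2
    rw [h2]; ring
  rw [← Real.mul_rpow (mul_pos hn0 hb).le hE.le, ← h1, one_div]
  have := Real.pow_rpow_inv_natCast (h.deriv_pos t ht).le (Nat.succ_ne_zero n)
  push_cast at this
  exact this.symm

/-- `∫₀^(ψ(t)-ψ(T)) (e^ξ - 1)^(-1/(n+1)) dξ = ((n+1)|b|)^(1/(n+1)) (t - T)`. -/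
theorem hornTime_eq (hn : 1 ≤ n) (h : IsHornPotential n a b T τ ψ) {t : ℝ} (ht : t ∈ Icc T τ) :
    hornTime n (ψ t - ψ T) = (((n : ℝ) + 1) * -b) ^ (1 / ((n : ℝ) + 1)) * (t - T) := by
  set k := (((n : ℝ) + 1) * -b) ^ (1 / ((n : ℝ) + 1)) with hk
  have hmono : ∀ r ∈ Icc T τ, ψ r - ψ T ∈ Icc 0 (ψ τ - ψ T) := fun r hr =>
    ⟨sub_nonneg.2 (h.strictMonoOn.monotoneOn ⟨le_rfl, h.T_lt.le⟩ hr hr.1),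
      sub_le_sub_right (h.strictMonoOn.monotoneOn hr ⟨h.T_lt.le, le_rfl⟩ hr.2) _⟩
  have hc : ContinuousOn (fun r => hornTime n (ψ r - ψ T) - k * (r - T)) (Icc T τ) := by
    refine ContinuousOn.sub ?_ (by fun_prop)
    exact (hornTime_continuousOn hn (ψ τ - ψ T)).comp (h.cont.sub continuousOn_const) hmono
  have hder : ∀ r ∈ Ioo T τ,
      HasDerivAt (fun r => hornTime n (ψ r - ψ T) - k * (r - T)) 0 r := by
    intro r hr
    have hlt : ψ T < ψ r := h.strictMonoOn ⟨le_rfl, h.T_lt.le⟩ ⟨hr.1.le, hr.2.le⟩ hr.1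
    have hE : 0 < Real.exp (ψ r - ψ T) - 1 := by
      have := Real.add_one_lt_exp (sub_pos.2 hlt).ne'
      linarith
    have h1 := (hornTime_hasDerivAt hn (sub_pos.2 hlt)).comp r ((h.hasDerivAt hr).sub_const (ψ T))
    have h2 := h1.sub (((hasDerivAt_id r).sub_const T).const_mul k)
    refine h2.congr_deriv ?_
    rw [Real.rpow_neg hE.le]
    have := (Real.rpow_pos_of_pos hE (1 / ((n : ℝ) + 1))).ne'
    field_simp
    simp [hk]
  rcases eq_or_lt_of_le ht.1 with rfl | hTt
  · simp [hornTime_zero]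
  · obtain ⟨x, hx, hx'⟩ := exists_hasDerivAt_eq_slope _ (fun _ => (0 : ℝ)) hTt
      (hc.mono (Icc_subset_Icc_right ht.2))
      (fun r hr => hder r ⟨hr.1, lt_of_lt_of_le hr.2 ht.2⟩)
    have h3 : t - T ≠ 0 := (sub_pos.2 hTt).ne'
    rw [eq_div_iff h3] at hx'
    simp [hornTime_zero] at hx'
    linarith

/-- The neck operator is the limit of the horn metrics: for horn potentials whose parameters
satisfy `τ/T → 0` and `b|τ|^(n+1) → 0`, the radial Laplacian
of `i∂∂̄ψ_T`, written in the coordinate `s = 1 - t/T`, tends to the one of `neckPotential`. -/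
theorem tendsto_radialLaplacian (hn : 1 ≤ n) {ι : Type*} {l : Filter ι} {a : ℝ} {b T τ : ι → ℝ}
    {ψ : ι → ℝ → ℝ} (h : ∀ i, IsHornPotential n a (b i) (T i) (τ i) (ψ i))
    (hτT : Tendsto (fun i => τ i / T i) l (𝓝 0))
    (hbτ : Tendsto (fun i => b i * |τ i| ^ (n + 1)) l (𝓝 0))
    (u : ℝ → ℝ) {s : ℝ} (hs : s ∈ Ioo (0 : ℝ) 1) :
    Tendsto (fun i => radialLaplacian n (ψ i) (fun t => u (1 - t / T i)) ((1 - s) * T i)) l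
      (𝓝 (radialLaplacian n (neckPotential n) u s)) := by
  have hφ := neckPotential_spec hn hs
  have hc := hornConst_pos hn
  have hn0 : (0 : ℝ) < (n : ℝ) + 1 := by positivity
  have hT : ∀ i, T i < 0 := fun i => (h i).T_lt.trans (h i).τ_neg
  set q := 1 / ((n : ℝ) + 1) with hq
  set k : ι → ℝ := fun i => (((n : ℝ) + 1) * -b i) ^ q with hk
  have hkpos : ∀ i, 0 < k i := fun i =>
    Real.rpow_pos_of_pos (mul_pos hn0 (neg_pos.2 (h i).b_neg)) _
  have htop : Tendsto (fun i => ψ i (τ i) - ψ i (T i)) l atTop := by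
    have h1 : ∀ i, ψ i (τ i) - ψ i (T i) =
        -Real.log (-(b i * |τ i| ^ (n + 1))) + n * Real.log ((n : ℝ) + 1) := by
      intro i
      have hb : 0 < -b i := neg_pos.2 (h i).b_neg
      have ht : 0 < -τ i := neg_pos.2 (h i).τ_neg
      have h2 : ψ i (T i) + a = Real.log (-b i) := by
        rw [← Real.log_exp (ψ i (T i) + a)]; congr 1; linarith [(h i).left]
      have h3 : -(b i * |τ i| ^ (n + 1)) = -b i * (-τ i) ^ (n + 1) := by
        rw [abs_of_neg (h i).τ_neg]; ring
      rw [h3, Real.log_mul hb.ne' (pow_pos ht _).ne', Real.log_pow, (h i).right]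
      push_cast
      linarith
    simp_rw [h1]
    refine tendsto_atTop_add_const_right _ _ (tendsto_neg_atBot_atTop.comp
      (Real.tendsto_log_nhdsGT_zero.comp (tendsto_nhdsWithin_iff.2 ⟨?_, ?_⟩)))
    · simpa using hbτ.neg
    · refine Eventually.of_forall fun i => ?_
      have : 0 < |τ i| := abs_pos.2 (h i).τ_neg.ne
      have := mul_pos (neg_pos.2 (h i).b_neg) (pow_pos this (n + 1))
      simp only [mem_Ioi]
      linarith
  have hκ : Tendsto (fun i => k i * -T i) l (𝓝 (hornConst n)) := by
    have h1 : ∀ i, hornTime n (ψ i (τ i) - ψ i (T i)) = (k i * -T i) * (1 - τ i / T i) := by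
      intro i
      rw [(h i).hornTime_eq hn ⟨(h i).T_lt.le, le_rfl⟩]
      change k i * _ = _
      have := (hT i).ne
      field_simp
      ring
    have h2 := (hornTime_tendsto hn).comp htop
    have h3 : Tendsto (fun i => 1 - τ i / T i) l (𝓝 1) := by simpa using hτT.const_sub 1
    have h4 := h2.div h3 one_ne_zero
    rw [div_one] at h4
    refine h4.congr' ?_
    filter_upwards [h3.eventually_const_lt zero_lt_one] with i hi
    simp only [Function.comp, Pi.div_apply, h1]
    field_simp
  have hmem : ∀ᶠ i in l, (1 - s) * T i ∈ Ioo (T i) (τ i) := by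
    filter_upwards [hτT.eventually_lt_const (sub_pos.2 hs.2)] with i hi
    rw [div_lt_iff_of_neg (hT i)] at hi
    refine ⟨?_, hi⟩
    nlinarith [hs.1, hT i]
  have hy : Tendsto (fun i => ψ i ((1 - s) * T i) - ψ i (T i)) l (𝓝 (neckPotential n s)) := by
    refine hornTime_tendsto_inverse hn hφ.1 ?_ ?_
    · filter_upwards [hmem] with i hi
      exact sub_nonneg.2 ((h i).strictMonoOn.monotoneOn ⟨le_rfl, (h i).T_lt.le⟩
        ⟨hi.1.le, hi.2.le⟩ hi.1.le)
    · rw [hφ.2]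
      refine (hκ.mul_const s).congr' ?_
      filter_upwards [hmem] with i hi
      rw [(h i).hornTime_eq hn ⟨hi.1.le, hi.2.le⟩]
      ring
  have hE0 : 0 < Real.exp (neckPotential n s) - 1 := by
    linarith [Real.add_one_lt_exp hφ.1.ne', hφ.1]
  have hlim : ∀ {p : ℝ}, Tendsto
      (fun i => (Real.exp (ψ i ((1 - s) * T i) - ψ i (T i)) - 1) ^ p) l
      (𝓝 ((Real.exp (neckPotential n s) - 1) ^ p)) := fun {p} =>
    (((Real.continuous_exp.tendsto _).comp hy).sub_const 1).rpow_const (Or.inl hE0.ne')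
  have hφ1 := (neckPotential_hasDerivAt hn hs).deriv
  have hφ2 := deriv_deriv_of_ode (n := n) (f := neckPotential n) (k := hornConst n) (m := 0)
    isOpen_Ioo (fun t ht => (neckPotential_spec hn ht).1)
    (fun t ht => by simpa using neckPotential_hasDerivAt hn ht) hs
  rw [sub_zero] at hφ2
  have hd1 : Tendsto (fun i => -T i * deriv (ψ i) ((1 - s) * T i)) l
      (𝓝 (deriv (neckPotential n) s)) := by
    rw [hφ1]
    refine (hκ.mul (hlim (p := q))).congr' ?_
    filter_upwards [hmem] with i hi
    rw [((h i).hasDerivAt hi).deriv]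
    ring
  have hd2 : Tendsto (fun i => (-T i) ^ 2 * deriv (deriv (ψ i)) ((1 - s) * T i)) l
      (𝓝 (deriv (deriv (neckPotential n)) s)) := by
    rw [hφ2]
    refine ((hκ.pow 2).mul (((((Real.continuous_exp.tendsto _).comp hy).const_mul q)).mul
      (hlim (p := 2 * q - 1)))).congr' ?_
    filter_upwards [hmem] with i hi
    rw [deriv_deriv_of_ode (n := n) (f := ψ i) (k := k i) (m := ψ i (T i)) isOpen_Ioo
      (fun t ht => (h i).strictMonoOn ⟨le_rfl, (h i).T_lt.le⟩ ⟨ht.1.le, ht.2.le⟩ ht.1)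
      (fun t ht => (h i).hasDerivAt ht) hi]
    simp only [Function.comp]
    ring
  have hφ1pos : deriv (neckPotential n) s ≠ 0 := by
    rw [hφ1]; exact (mul_pos hc (Real.rpow_pos_of_pos hE0 _)).ne'
  have hφ2pos : deriv (deriv (neckPotential n)) s ≠ 0 := by
    rw [hφ2]; have := Real.rpow_pos_of_pos hE0 (2 * q - 1); positivity
  have hu : ∀ (v : ℝ → ℝ) (i : ι), deriv (fun t => v (1 - t / T i)) =
      fun t => -(T i)⁻¹ * deriv v (1 - t / T i) := by
    intro v i
    funext t
    have h1 := deriv_comp_mul_left (T i)⁻¹ (fun x => v (1 - x)) t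
    rw [deriv_comp_const_sub, smul_eq_mul] at h1
    have h2 : (fun t => v (1 - t / T i)) = fun t => v (1 - (T i)⁻¹ * t) := by
      funext t; rw [div_eq_inv_mul]
    rw [h2, h1, div_eq_inv_mul]
    ring
  have hkey := (hd2.inv₀ hφ2pos).const_mul (deriv (deriv u) s) |>.add
    (((hd1.inv₀ hφ1pos).const_mul (deriv u s)).const_mul ((n : ℝ) - 1))
  simp only [← div_eq_mul_inv] at hkey
  refine hkey.congr fun i => ?_
  have hTi := (hT i).ne
  have hsT : 1 - (1 - s) * T i / T i = s := by field_simp; ring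
  unfold radialLaplacian
  rw [hu u i]
  simp only [deriv_const_mul_field']
  rw [hu (deriv u) i]
  simp only [hsT]
  congr 1
  · rw [neg_sq, div_mul_eq_div_div]
    field_simp
  · congr 1
    rw [div_mul_eq_div_div, div_neg]
    field_simp

end IsHornPotential

end Facts

end

noncomputable section

/-! Write `w` for `neckSlope`, `c` for `hornConst n` and `κ = c/(n+1)` for `neckRate`, so that `φ' =
c w`. The potential solves `φ'^(n-1) φ'' = const · e^φ`, and the neck operator is the linearization
of `(n-1) log φ' + log φ'' - φ`. Symmetries of the nonlinear equation therefore give elements of the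
kernel. Translation in `s` gives `φ'`, a multiple of `w`. Dilation about `s = 1` by a factor `λ`,
together with the addition of `(n+1) log λ`, gives `(n+1) - (1-s) φ'`, which is `n+1` times
`neckDecaying = 1 - κ w (1-s)`.

The code checks both solutions directly (`neckSlope_isNeckSolution`, `neckDecaying_isNeckSolution`)
from the autonomous equation `w' = κ (1 + w^(n+1)) / w^(n-1)`. Their weighted Wronskian is the
nonzero constant `-κ`, so they span all solutions (`IsNeckSolution.exists_eq_combination`). Since `w
→ ∞` at `1` while `neckDecaying → 0` there, boundedness near `1` excludes `w`; this yields
uniqueness and (4).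

What remains is the behaviour of `w` at the two ends. Near `1`, `(1/w)' = -κ (1 + w^(-(n+1)))`, so
`1/w` is `κ(1-s)` up to a small error, and `neckDecaying` is `w` times that error
(`neckSlope_inv_gap_lt`, `neckDecaying_isBigO`). Near `0`, `(w^n)' = nκ (1 + w^(n+1))`, so `w` is `b
= (nκs)^(1/n)`, called `neckLeading`, up to `O(w^(n+2))`. Multiplying `b` by `κ(1-s)` produces both
explicit terms of (3). Bounds on derivatives follow algebraically from the equation for `w`. -/

/-- The function `(e^φ - 1)^(1/(n+1))` of the neck potential `φ`, i.e. `φ' / c(n)`. -/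
def neckSlope (n : ℕ) (s : ℝ) : ℝ :=
  (Real.exp (neckPotential n s) - 1) ^ (1 / ((n : ℝ) + 1))

/-- The constant `c(n) / (n+1)`. -/
def neckRate (n : ℕ) : ℝ := hornConst n / ((n : ℝ) + 1)

/-- The derivative of `neckSlope`, expressed through `neckSlope`. -/
def neckSlopeDeriv (n : ℕ) (s : ℝ) : ℝ :=
  neckRate n * ((1 + neckSlope n s ^ (n + 1)) / neckSlope n s ^ (n - 1))

/-- The decaying solution of the limit neck equation. -/
def neckDecaying (n : ℕ) (s : ℝ) : ℝ := 1 - neckRate n * (neckSlope n s * (1 - s))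

/-- The derivative of `neckDecaying`. -/
def neckDecayingDeriv (n : ℕ) (s : ℝ) : ℝ :=
  -(neckRate n * (neckSlopeDeriv n s * (1 - s) - neckSlope n s))

/-! ### Calculus on open intervals -/

theorem contDiffOn_two_of_hasDerivAt {U : Set ℝ} (hU : IsOpen U) {f f' f'' : ℝ → ℝ}
    (h1 : ∀ s ∈ U, HasDerivAt f (f' s) s) (h2 : ∀ s ∈ U, HasDerivAt f' (f'' s) s)
    (h3 : ContinuousOn f'' U) : ContDiffOn ℝ 2 f U := by
  have h1' : EqOn (deriv f) f' U := fun s hs => (h1 s hs).deriv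
  have h2' : EqOn (deriv f') f'' U := fun s hs => (h2 s hs).deriv
  rw [show (2 : WithTop ℕ∞) = 1 + 1 by norm_num, contDiffOn_succ_iff_deriv_of_isOpen hU]
  refine ⟨fun s hs => (h1 s hs).differentiableAt.differentiableWithinAt, by simp, ?_⟩
  refine ContDiffOn.congr ?_ h1'
  rw [show (1 : WithTop ℕ∞) = 0 + 1 by norm_num, contDiffOn_succ_iff_deriv_of_isOpen hU]
  refine ⟨fun s hs => (h2 s hs).differentiableAt.differentiableWithinAt, by simp, ?_⟩
  exact (contDiffOn_zero.2 h3).congr h2'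

theorem deriv_deriv_of_hasDerivAt {U : Set ℝ} (hU : IsOpen U) {f f' : ℝ → ℝ} {f'' s : ℝ}
    (h1 : ∀ s ∈ U, HasDerivAt f (f' s) s) (hs : s ∈ U) (h2 : HasDerivAt f' f'' s) :
    deriv (deriv f) s = f'' := by
  have h : deriv f =ᶠ[𝓝 s] f' := Filter.mem_of_superset (hU.mem_nhds hs) fun r hr => (h1 r hr).deriv
  rw [h.deriv_eq, h2.deriv]

/-- Stands in for integrating `f'` up to the endpoint `b`, where `f` need not be defined suitably;
with its mirror image below it yields all the strict estimates on `w`. -/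
theorem pos_of_hasDerivAt_neg_of_tendsto_right {f f' : ℝ → ℝ} {a b s : ℝ}
    (h : ∀ r ∈ Ioo a b, HasDerivAt f (f' r) r) (hneg : ∀ r ∈ Ioo a b, f' r < 0)
    (hl : Tendsto f (𝓝[<] b) (𝓝 0)) (hs : s ∈ Ioo a b) : 0 < f s := by
  have hanti : StrictAntiOn f (Ioo a b) := by
    refine strictAntiOn_of_deriv_neg (convex_Ioo a b)
      (fun r hr => (h r hr).continuousAt.continuousWithinAt) ?_
    rw [interior_Ioo]
    intro r hr
    rw [(h r hr).deriv]
    exact hneg r hr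
  obtain ⟨t, hst, htb⟩ := exists_between hs.2
  have ht : t ∈ Ioo a b := ⟨hs.1.trans hst, htb⟩
  refine lt_of_le_of_lt (le_of_tendsto hl ?_) (hanti hs ht hst)
  filter_upwards [Ioo_mem_nhdsLT htb] with r hr
  exact (hanti ht ⟨ht.1.trans hr.1, hr.2⟩ hr.1).le

theorem pos_of_hasDerivAt_pos_of_tendsto_left {f f' : ℝ → ℝ} {a b s : ℝ}
    (h : ∀ r ∈ Ioo a b, HasDerivAt f (f' r) r) (hpos : ∀ r ∈ Ioo a b, 0 < f' r)
    (hl : Tendsto f (𝓝[>] a) (𝓝 0)) (hs : s ∈ Ioo a b) : 0 < f s := by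
  have hmono : StrictMonoOn f (Ioo a b) := by
    refine strictMonoOn_of_deriv_pos (convex_Ioo a b)
      (fun r hr => (h r hr).continuousAt.continuousWithinAt) ?_
    rw [interior_Ioo]
    intro r hr
    rw [(h r hr).deriv]
    exact hpos r hr
  obtain ⟨t, hat, hts⟩ := exists_between hs.1
  have ht : t ∈ Ioo a b := ⟨hat, hts.trans hs.2⟩
  refine lt_of_le_of_lt (le_of_tendsto hl ?_) (hmono ht hs hts)
  filter_upwards [Ioo_mem_nhdsGT hat] with r hr
  exact (hmono ⟨hr.1, hr.2.trans ht.2⟩ ht hr.2).le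

/-! ### The slope `w` and its autonomous differential equation -/

section Neck

variable {n : ℕ} {s : ℝ}

theorem neckRate_pos (hn : 1 ≤ n) : 0 < neckRate n :=
  div_pos (hornConst_pos hn) (by positivity)

theorem hornConst_eq : hornConst n = ((n : ℝ) + 1) * neckRate n := by
  have : (n : ℝ) + 1 ≠ 0 := by positivity
  unfold neckRate
  field_simp

theorem exp_neckPotential_sub_one_pos (hn : 1 ≤ n) (hs : s ∈ Ioo (0 : ℝ) 1) :
    0 < Real.exp (neckPotential n s) - 1 := by
  have h := (neckPotential_spec hn hs).1
  linarith [Real.add_one_lt_exp h.ne']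

theorem neckSlope_pos (hn : 1 ≤ n) (hs : s ∈ Ioo (0 : ℝ) 1) : 0 < neckSlope n s :=
  Real.rpow_pos_of_pos (exp_neckPotential_sub_one_pos hn hs) _

theorem neckSlope_pow_succ (hn : 1 ≤ n) (hs : s ∈ Ioo (0 : ℝ) 1) :
    neckSlope n s ^ (n + 1) = Real.exp (neckPotential n s) - 1 := by
  have h := Real.rpow_inv_natCast_pow (exp_neckPotential_sub_one_pos hn hs).le (Nat.succ_ne_zero n)
  push_cast at h
  rw [neckSlope, one_div, h]

theorem neckPotential_hasDerivAt_neckSlope (hn : 1 ≤ n) (hs : s ∈ Ioo (0 : ℝ) 1) :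
    HasDerivAt (neckPotential n) (hornConst n * neckSlope n s) s :=
  neckPotential_hasDerivAt hn hs

theorem neckSlopeDeriv_pos (hn : 1 ≤ n) (hs : s ∈ Ioo (0 : ℝ) 1) : 0 < neckSlopeDeriv n s := by
  have := neckSlope_pos hn hs
  have := neckRate_pos hn
  unfold neckSlopeDeriv
  positivity

theorem neckSlope_hasDerivAt (hn : 1 ≤ n) (hs : s ∈ Ioo (0 : ℝ) 1) :
    HasDerivAt (neckSlope n) (neckSlopeDeriv n s) s := by
  have hE := exp_neckPotential_sub_one_pos hn hs
  have hw := neckSlope_pos hn hs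
  have h := ((neckPotential_hasDerivAt_neckSlope hn hs).exp.sub_const 1).rpow_const
    (p := 1 / ((n : ℝ) + 1)) (Or.inl hE.ne')
  refine h.congr_deriv ?_
  have h1 : Real.exp (neckPotential n s) = 1 + neckSlope n s ^ (n + 1) := by
    rw [neckSlope_pow_succ hn hs]; ring
  rw [Real.rpow_sub hE, Real.rpow_one, ← neckSlope, ← neckSlope_pow_succ hn hs, h1, hornConst_eq,
    neckSlopeDeriv]
  -- Writing `n = m + 1` removes the truncated subtraction in the exponent `n - 1`.
  obtain ⟨m, rfl⟩ := Nat.exists_eq_add_of_le' hn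
  simp only [Nat.add_sub_cancel]
  have : (((m + 1 : ℕ) : ℝ) + 1) ≠ 0 := by positivity
  field_simp
  ring

/-- With `w' = g(w)` and `g(w) = κ (w^(1-n) + w^2)`, the second derivative is `w' g'(w)`. -/
theorem neckSlopeDeriv_hasDerivAt (hn : 1 ≤ n) (hs : s ∈ Ioo (0 : ℝ) 1) :
    HasDerivAt (neckSlopeDeriv n) (neckSlopeDeriv n s *
      (neckRate n * (2 * neckSlope n s - ((n : ℝ) - 1) / neckSlope n s ^ n))) s := by
  have hw := neckSlope_pos hn hs
  have hd := neckSlope_hasDerivAt hn hs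
  have h := (((hd.pow (n + 1)).const_add 1).div (hd.pow (n - 1)) (pow_pos hw _).ne').const_mul
    (neckRate n)
  refine h.congr_deriv ?_
  obtain ⟨m, rfl⟩ := Nat.exists_eq_add_of_le' hn
  simp only [Nat.add_sub_cancel]
  -- For `n = 1` the factor `w^(n-1)` is constant and the exponent `n - 2` would be truncated, so
  -- this case is separate.
  rcases m with _ | m
  · simp; ring
  · simp only [Nat.add_sub_cancel, Pi.pow_apply]
    push_cast
    unfold neckSlopeDeriv
    simp only [Nat.add_sub_cancel]
    field_simp
    ring

theorem neckSlope_continuousOn (hn : 1 ≤ n) : ContinuousOn (neckSlope n) (Ioo 0 1) :=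
  fun _ hs => (neckSlope_hasDerivAt hn hs).continuousAt.continuousWithinAt

theorem neckSlopeDeriv_continuousOn (hn : 1 ≤ n) : ContinuousOn (neckSlopeDeriv n) (Ioo 0 1) :=
  fun _ hs => (neckSlopeDeriv_hasDerivAt hn hs).continuousAt.continuousWithinAt

theorem neckSlopeDeriv_deriv_continuousOn (hn : 1 ≤ n) :
    ContinuousOn (fun s => neckSlopeDeriv n s *
      (neckRate n * (2 * neckSlope n s - ((n : ℝ) - 1) / neckSlope n s ^ n))) (Ioo 0 1) :=
  (neckSlopeDeriv_continuousOn hn).mul (continuousOn_const.mul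
    ((continuousOn_const.mul (neckSlope_continuousOn hn)).sub
      (continuousOn_const.div ((neckSlope_continuousOn hn).pow n)
        fun _ hs => (pow_pos (neckSlope_pos hn hs) n).ne')))

/-! ### Boundary values of `φ` and `w` -/

theorem neckPotential_tendsto_zero (hn : 1 ≤ n) :
    Tendsto (neckPotential n) (𝓝[>] 0) (𝓝 0) := by
  have hc := hornConst_pos hn
  have hI : ∀ᶠ s : ℝ in 𝓝[>] 0, s ∈ Ioo (0 : ℝ) 1 := Ioo_mem_nhdsGT one_pos
  rw [tendsto_order]
  constructor
  · intro a ha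
    filter_upwards [hI] with s hs
    exact ha.trans (neckPotential_spec hn hs).1
  · intro a ha
    have h0 : 0 < hornTime n a := by
      have := hornTime_strictMonoOn hn (mem_Ici.2 le_rfl) (mem_Ici.2 ha.le) ha
      rwa [hornTime_zero] at this
    filter_upwards [hI, Ioo_mem_nhdsGT (div_pos h0 hc)] with s hs hs'
    obtain ⟨h1, h2⟩ := neckPotential_spec hn hs
    refine ((hornTime_strictMonoOn hn).lt_iff_lt h1.le ha.le).1 ?_
    rw [h2]
    have := (lt_div_iff₀ hc).1 hs'.2
    linarith

theorem neckPotential_tendsto_atTop (hn : 1 ≤ n) :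
    Tendsto (neckPotential n) (𝓝[<] 1) atTop := by
  have hc := hornConst_pos hn
  have hI : ∀ᶠ s : ℝ in 𝓝[<] 1, s ∈ Ioo (0 : ℝ) 1 := Ioo_mem_nhdsLT one_pos
  refine (atTop_basis_Ioi' (0 : ℝ)).tendsto_right_iff.2 fun a ha => ?_
  have h0 : hornTime n a / hornConst n < 1 := (div_lt_one hc).2 (hornTime_lt hn ha.le)
  filter_upwards [hI, Ioo_mem_nhdsLT h0] with s hs hs'
  obtain ⟨h1, h2⟩ := neckPotential_spec hn hs
  refine ((hornTime_strictMonoOn hn).lt_iff_lt ha.le h1.le).1 ?_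
  rw [h2]
  have := (div_lt_iff₀ hc).1 hs'.1
  linarith

theorem neckSlope_tendsto_zero (hn : 1 ≤ n) : Tendsto (neckSlope n) (𝓝[>] 0) (𝓝 0) := by
  have h := (((Real.continuous_exp.tendsto _).comp (neckPotential_tendsto_zero hn)).sub_const
    1).rpow_const (p := 1 / ((n : ℝ) + 1)) (Or.inr hornExp_pos.le)
  rwa [Real.exp_zero, sub_self, Real.zero_rpow (hornExp_pos (n := n)).ne'] at h

theorem neckSlope_tendsto_atTop (hn : 1 ≤ n) : Tendsto (neckSlope n) (𝓝[<] 1) atTop :=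
  (tendsto_rpow_atTop hornExp_pos).comp
    (tendsto_atTop_add_const_right _ (-1)
      (Real.tendsto_exp_atTop.comp (neckPotential_tendsto_atTop hn)))

/-! ### The neck equation -/

/-- Substituting `φ' = c w` and `φ'' = c w'` eliminates `φ`; from here on only `w` and its equation
matter. -/
theorem neckOperator_eq_zero_iff (hn : 1 ≤ n) (u : ℝ → ℝ) (hs : s ∈ Ioo (0 : ℝ) 1) :
    neckOperator n u s = 0 ↔ deriv (deriv u) s = neckSlopeDeriv n s *
      (hornConst n * u s - ((n : ℝ) - 1) * deriv u s / neckSlope n s) := by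
  have hc := hornConst_pos hn
  have hw := neckSlope_pos hn hs
  have hg := neckSlopeDeriv_pos hn hs
  have h1 := (neckPotential_hasDerivAt_neckSlope hn hs).deriv
  have h2 := deriv_deriv_of_hasDerivAt isOpen_Ioo
    (fun r hr => neckPotential_hasDerivAt_neckSlope hn hr) hs
    ((neckSlope_hasDerivAt hn hs).const_mul (hornConst n))
  rw [neckOperator, radialLaplacian, h1, h2]
  constructor
  · intro h
    field_simp at h ⊢
    linear_combination h
  · intro h
    rw [h]
    field_simp
    ring

theorem isNeckSolution_of_hasDerivAt (hn : 1 ≤ n) {u u' u'' : ℝ → ℝ}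
    (h1 : ∀ s ∈ Ioo (0 : ℝ) 1, HasDerivAt u (u' s) s)
    (h2 : ∀ s ∈ Ioo (0 : ℝ) 1, HasDerivAt u' (u'' s) s)
    (h3 : ContinuousOn u'' (Ioo 0 1))
    (h : ∀ s ∈ Ioo (0 : ℝ) 1, u'' s = neckSlopeDeriv n s *
      (hornConst n * u s - ((n : ℝ) - 1) * u' s / neckSlope n s)) : IsNeckSolution n u := by
  refine ⟨contDiffOn_two_of_hasDerivAt isOpen_Ioo h1 h2 h3, fun s hs => ?_⟩
  rw [neckOperator_eq_zero_iff hn u hs, deriv_deriv_of_hasDerivAt isOpen_Ioo h1 hs (h2 s hs),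
    (h1 s hs).deriv, h s hs]

theorem neckSlope_isNeckSolution (hn : 1 ≤ n) : IsNeckSolution n (neckSlope n) := by
  refine isNeckSolution_of_hasDerivAt hn (fun s hs => neckSlope_hasDerivAt hn hs)
    (fun s hs => neckSlopeDeriv_hasDerivAt hn hs) (neckSlopeDeriv_deriv_continuousOn hn)
    fun s hs => ?_
  have hw := neckSlope_pos hn hs
  congr 1
  rw [hornConst_eq, neckSlopeDeriv]
  obtain ⟨m, rfl⟩ := Nat.exists_eq_add_of_le' hn
  simp only [Nat.add_sub_cancel]
  field_simp
  ring

theorem neckDecaying_hasDerivAt (hn : 1 ≤ n) (hs : s ∈ Ioo (0 : ℝ) 1) :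
    HasDerivAt (neckDecaying n) (neckDecayingDeriv n s) s := by
  have h := (((neckSlope_hasDerivAt hn hs).mul ((hasDerivAt_id s).const_sub 1)).const_mul
    (neckRate n)).const_sub 1
  refine h.congr_deriv ?_
  simp only [neckDecayingDeriv, id]
  ring

theorem neckDecayingDeriv_hasDerivAt (hn : 1 ≤ n) (hs : s ∈ Ioo (0 : ℝ) 1) :
    HasDerivAt (neckDecayingDeriv n) (-(neckRate n * (neckSlopeDeriv n s *
      (neckRate n * (2 * neckSlope n s - ((n : ℝ) - 1) / neckSlope n s ^ n)) * (1 - s)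
      - 2 * neckSlopeDeriv n s))) s := by
  have h := ((((neckSlopeDeriv_hasDerivAt hn hs).mul ((hasDerivAt_id s).const_sub 1)).sub
    (neckSlope_hasDerivAt hn hs)).const_mul (neckRate n)).neg
  refine h.congr_deriv ?_
  simp only [id]
  ring

theorem neckDecaying_isNeckSolution (hn : 1 ≤ n) : IsNeckSolution n (neckDecaying n) := by
  refine isNeckSolution_of_hasDerivAt hn (fun s hs => neckDecaying_hasDerivAt hn hs)
    (fun s hs => neckDecayingDeriv_hasDerivAt hn hs) ?_ fun s hs => ?_
  · exact (continuousOn_const.mul (((neckSlopeDeriv_deriv_continuousOn hn).mul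
      (continuousOn_const.sub continuousOn_id)).sub
        (continuousOn_const.mul (neckSlopeDeriv_continuousOn hn)))).neg
  have hw := neckSlope_pos hn hs
  rw [hornConst_eq, neckDecaying, neckDecayingDeriv]
  have hg : neckSlopeDeriv n s = neckRate n * (neckSlope n s / neckSlope n s ^ n
      + neckSlope n s ^ 2) := by
    rw [neckSlopeDeriv]
    obtain ⟨m, rfl⟩ := Nat.exists_eq_add_of_le' hn
    simp only [Nat.add_sub_cancel]
    field_simp
    ring
  have h : (n - 1) * -(neckRate n * (neckSlopeDeriv n s * (1 - s) - neckSlope n s)) / neckSlope n s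
      = (n - 1) * -(neckRate n * (neckRate n * (1 / neckSlope n s ^ n + neckSlope n s) * (1 - s)
        - 1)) := by
    rw [hg]; field_simp
  rw [h]
  ring

/-- The Wronskian of two solutions, weighted by `neckSlope ^ (n - 1)`, is constant. -/
theorem IsNeckSolution.wronskian_const (hn : 1 ≤ n) {u v : ℝ → ℝ} (hu : IsNeckSolution n u)
    (hv : IsNeckSolution n v) : ∃ a : ℝ, ∀ s ∈ Ioo (0 : ℝ) 1,
      (u s * deriv v s - deriv u s * v s) * neckSlope n s ^ (n - 1) = a := by
  have hd1 : ∀ {f : ℝ → ℝ}, IsNeckSolution n f → ∀ s ∈ Ioo (0 : ℝ) 1,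
      HasDerivAt f (deriv f s) s := fun hf s hs =>
    ((hf.1.differentiableOn (by norm_num)).differentiableAt (isOpen_Ioo.mem_nhds hs)).hasDerivAt
  have hd2 : ∀ {f : ℝ → ℝ}, IsNeckSolution n f → ∀ s ∈ Ioo (0 : ℝ) 1,
      HasDerivAt (deriv f) (neckSlopeDeriv n s *
        (hornConst n * f s - ((n : ℝ) - 1) * deriv f s / neckSlope n s)) s := by
    intro f hf s hs
    rw [← (neckOperator_eq_zero_iff hn f hs).1 (hf.2 s hs)]
    have h : ContDiffOn ℝ 1 (deriv f) (Ioo 0 1) :=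
      ((contDiffOn_succ_iff_deriv_of_isOpen (n := 1) isOpen_Ioo).1
        (by rw [one_add_one_eq_two]; exact hf.1)).2.2
    exact ((h.differentiableOn (by norm_num)).differentiableAt
      (isOpen_Ioo.mem_nhds hs)).hasDerivAt
  -- Abel's formula: the first-order coefficient is `(n-1) w'/w`, so `w^(n-1)` is the integrating
  -- factor.
  have hder : ∀ s ∈ Ioo (0 : ℝ) 1, HasDerivAt
      (fun s => (u s * deriv v s - deriv u s * v s) * neckSlope n s ^ (n - 1)) 0 s := by
    intro s hs
    have hw := neckSlope_pos hn hs
    have h := (((hd1 hu s hs).mul (hd2 hv s hs)).sub ((hd2 hu s hs).mul (hd1 hv s hs))).mul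
      ((neckSlope_hasDerivAt hn hs).pow (n - 1))
    refine h.congr_deriv ?_
    obtain ⟨m, rfl⟩ := Nat.exists_eq_add_of_le' hn
    simp only [Nat.add_sub_cancel, Pi.mul_apply, Pi.sub_apply, Pi.pow_apply]
    rcases m with _ | m
    · simp; ring
    · simp only [Nat.add_sub_cancel]
      push_cast
      field_simp
      ring
  refine ⟨_, fun s hs => isOpen_Ioo.is_const_of_deriv_eq_zero isPreconnected_Ioo
    (fun r hr => (hder r hr).differentiableAt.differentiableWithinAt)
    (fun r hr => (hder r hr).deriv) hs (show (1 / 2 : ℝ) ∈ Ioo (0 : ℝ) 1 by norm_num)⟩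

theorem neckDecaying_wronskian (hn : 1 ≤ n) (hs : s ∈ Ioo (0 : ℝ) 1) :
    (neckSlope n s * deriv (neckDecaying n) s - deriv (neckSlope n) s * neckDecaying n s) *
      neckSlope n s ^ (n - 1) = -neckRate n := by
  have hw := neckSlope_pos hn hs
  rw [(neckDecaying_hasDerivAt hn hs).deriv, (neckSlope_hasDerivAt hn hs).deriv,
    neckDecayingDeriv, neckDecaying, neckSlopeDeriv]
  obtain ⟨m, rfl⟩ := Nat.exists_eq_add_of_le' hn
  simp only [Nat.add_sub_cancel]
  field_simp
  ring

/-- The 3 × 3 determinant with two equal rows `(u, w, v)` and one row of derivatives vanishes, where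
`v` is `neckDecaying`. Expanding it writes `u` times the Wronskian of `w, v` as a combination of `w`
and `v` with constant coefficients. -/
theorem IsNeckSolution.exists_eq_combination (hn : 1 ≤ n) {u : ℝ → ℝ} (hu : IsNeckSolution n u) :
    ∃ a b : ℝ, ∀ s ∈ Ioo (0 : ℝ) 1, u s = a * neckSlope n s + b * neckDecaying n s := by
  obtain ⟨a, ha⟩ := hu.wronskian_const hn (neckDecaying_isNeckSolution hn)
  obtain ⟨b, hb⟩ := hu.wronskian_const hn (neckSlope_isNeckSolution hn)
  have hk := (neckRate_pos hn).ne'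
  refine ⟨-a / neckRate n, b / neckRate n, fun s hs => ?_⟩
  have h := neckDecaying_wronskian hn hs
  have h1 := ha s hs
  have h2 := hb s hs
  field_simp
  linear_combination u s * h - neckSlope n s * h1 + neckDecaying n s * h2

/-! ### Behaviour of the decaying solution near `1` -/

theorem one_sub_tendsto_zero : Tendsto (fun s : ℝ => 1 - s) (𝓝[<] 1) (𝓝 0) := by
  have h : Tendsto (fun s : ℝ => 1 - s) (𝓝 1) (𝓝 (1 - 1)) := tendsto_id.const_sub 1
  rw [sub_self] at h
  exact h.mono_left nhdsWithin_le_nhds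

/-- If `w' = κ w^2` held exactly, `1/w` would be `κ(1-s)`; the gap collects the lower-order term of
`w'`. -/
theorem neckSlope_inv_gap_hasDerivAt (hn : 1 ≤ n) (hs : s ∈ Ioo (0 : ℝ) 1) :
    HasDerivAt (fun s => (neckSlope n s)⁻¹ - neckRate n * (1 - s))
      (-(neckRate n / neckSlope n s ^ (n + 1))) s := by
  have hw := neckSlope_pos hn hs
  have h := ((neckSlope_hasDerivAt hn hs).inv hw.ne').sub
    (((hasDerivAt_id s).const_sub 1).const_mul (neckRate n))
  refine h.congr_deriv ?_
  rw [neckSlopeDeriv]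
  obtain ⟨m, rfl⟩ := Nat.exists_eq_add_of_le' hn
  simp only [Nat.add_sub_cancel]
  field_simp
  ring

theorem neckSlope_inv_gap_tendsto (hn : 1 ≤ n) :
    Tendsto (fun s => (neckSlope n s)⁻¹ - neckRate n * (1 - s)) (𝓝[<] 1) (𝓝 0) := by
  simpa using (neckSlope_tendsto_atTop hn).inv_tendsto_atTop.sub
    (one_sub_tendsto_zero.const_mul (neckRate n))

theorem neckSlope_inv_gap_pos (hn : 1 ≤ n) (hs : s ∈ Ioo (0 : ℝ) 1) :
    0 < (neckSlope n s)⁻¹ - neckRate n * (1 - s) :=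
  pos_of_hasDerivAt_neg_of_tendsto_right
    (f := fun s => (neckSlope n s)⁻¹ - neckRate n * (1 - s))
    (fun _ hr => neckSlope_inv_gap_hasDerivAt hn hr)
    (fun _ hr => neg_neg_of_pos (div_pos (neckRate_pos hn) (pow_pos (neckSlope_pos hn hr) _)))
    (neckSlope_inv_gap_tendsto hn) hs

/-- The gap is the integral of `κ w^(-(n+1))` over `(s, 1)`, and the integrand is decreasing. In the
derivative of the difference the terms `κ w^(-(n+1))` cancel, leaving only the one from
differentiating that power. -/
theorem neckSlope_inv_gap_lt (hn : 1 ≤ n) (hs : s ∈ Ioo (0 : ℝ) 1) :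
    (neckSlope n s)⁻¹ - neckRate n * (1 - s) <
      neckRate n * (1 - s) * (neckSlope n s)⁻¹ ^ (n + 1) := by
  have hk := neckRate_pos hn
  rw [← sub_pos]
  refine pos_of_hasDerivAt_neg_of_tendsto_right
    (f := fun s => neckRate n * (1 - s) * (neckSlope n s)⁻¹ ^ (n + 1) -
      ((neckSlope n s)⁻¹ - neckRate n * (1 - s)))
    (f' := fun s => -(neckRate n * (1 - s) * ((n + 1) * (neckSlope n s)⁻¹ ^ n *
      (neckSlopeDeriv n s / neckSlope n s ^ 2)))) (fun r hr => ?_) (fun r hr => ?_) ?_ hs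
  · have hw := neckSlope_pos hn hr
    have h := ((((hasDerivAt_id r).const_sub 1).const_mul (neckRate n)).mul
      (((neckSlope_hasDerivAt hn hr).inv hw.ne').pow (n + 1))).sub
      (neckSlope_inv_gap_hasDerivAt hn hr)
    refine h.congr_deriv ?_
    simp only [Nat.add_sub_cancel, id, Pi.inv_apply, Pi.pow_apply, inv_pow]
    push_cast
    field_simp
    ring
  · have hw := neckSlope_pos hn hr
    have hg := neckSlopeDeriv_pos hn hr
    have : 0 < 1 - r := sub_pos.2 hr.2
    exact neg_neg_of_pos (by positivity)
  · simpa using ((one_sub_tendsto_zero.const_mul (neckRate n)).mul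
      ((neckSlope_tendsto_atTop hn).inv_tendsto_atTop.pow (n + 1))).sub
      (neckSlope_inv_gap_tendsto hn)

theorem neckDecaying_eq_mul (hn : 1 ≤ n) (hs : s ∈ Ioo (0 : ℝ) 1) :
    neckDecaying n s = neckSlope n s * ((neckSlope n s)⁻¹ - neckRate n * (1 - s)) := by
  have hw := (neckSlope_pos hn hs).ne'
  rw [mul_sub, mul_inv_cancel₀ hw, neckDecaying]
  ring

theorem neckDecaying_pos (hn : 1 ≤ n) (hs : s ∈ Ioo (0 : ℝ) 1) : 0 < neckDecaying n s := by
  rw [neckDecaying_eq_mul hn hs]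
  exact mul_pos (neckSlope_pos hn hs) (neckSlope_inv_gap_pos hn hs)

theorem neckDecaying_isBigO (hn : 1 ≤ n) :
    neckDecaying n =O[𝓝[<] 1] fun s => (1 - s) ^ (n + 1) := by
  have hk := neckRate_pos hn
  refine IsBigO.of_bound (neckRate n * (2 * neckRate n) ^ n) ?_
  have hI : ∀ᶠ s : ℝ in 𝓝[<] 1, s ∈ Ioo (0 : ℝ) 1 := Ioo_mem_nhdsLT one_pos
  filter_upwards [hI, (neckSlope_tendsto_atTop hn).eventually_ge_atTop 1] with s hs h1
  have hw := neckSlope_pos hn hs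
  have hη : 0 < 1 - s := sub_pos.2 hs.2
  have hlt := neckSlope_inv_gap_lt hn hs
  have hi : (neckSlope n s)⁻¹ ≤ 1 := inv_le_one_of_one_le₀ h1
  -- Once `1/w ≤ 1`, the gap is at most `κ(1-s)`, whence the factor `2`.
  have h2 : (neckSlope n s)⁻¹ ≤ 2 * neckRate n * (1 - s) := by
    have : neckRate n * (1 - s) * (neckSlope n s)⁻¹ ^ (n + 1) ≤ neckRate n * (1 - s) :=
      mul_le_of_le_one_right (by positivity) (pow_le_one₀ (by positivity) hi)
    linarith
  rw [Real.norm_of_nonneg (neckDecaying_pos hn hs).le, Real.norm_of_nonneg (by positivity)]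
  calc neckDecaying n s
      ≤ neckSlope n s * (neckRate n * (1 - s) * (neckSlope n s)⁻¹ ^ (n + 1)) := by
        rw [neckDecaying_eq_mul hn hs]; gcongr
    _ = neckRate n * (1 - s) * (neckSlope n s)⁻¹ ^ n := by
        rw [pow_succ]; field_simp
    _ ≤ neckRate n * (1 - s) * (2 * neckRate n * (1 - s)) ^ n := by gcongr
    _ = neckRate n * (2 * neckRate n) ^ n * (1 - s) ^ (n + 1) := by rw [mul_pow]; ring

theorem neckDecaying_tendsto_zero (hn : 1 ≤ n) :
    Tendsto (neckDecaying n) (𝓝[<] 1) (𝓝 0) :=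
  (neckDecaying_isBigO hn).trans_tendsto (by simpa using one_sub_tendsto_zero.pow (n + 1))

theorem neckDecaying_tendsto_one (hn : 1 ≤ n) :
    Tendsto (neckDecaying n) (𝓝[>] 0) (𝓝 1) := by
  have h : Tendsto (fun s : ℝ => 1 - s) (𝓝[>] 0) (𝓝 (1 - 0)) :=
    (tendsto_id.const_sub 1).mono_left nhdsWithin_le_nhds
  have h' := (((neckSlope_tendsto_zero hn).mul h).const_mul (neckRate n)).const_sub 1
  rwa [zero_mul, mul_zero, sub_zero] at h'

/-! ### Monotonicity of the decaying solution -/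

theorem neckDecayingDeriv_neg (hn : 1 ≤ n) (hs : s ∈ Ioo (0 : ℝ) 1) :
    neckDecayingDeriv n s < 0 := by
  have hk := neckRate_pos hn
  -- The sign of the derivative is decided by `w'(1-s) - w`. Dividing by `w' > 0` gives a function
  -- that tends to `0` at `1` and has derivative `-(n+1)/(1 + w^(n+1))`.
  have hpos : 0 < 1 - s - neckSlope n s / neckSlopeDeriv n s := by
    refine pos_of_hasDerivAt_neg_of_tendsto_right
      (f := fun s => 1 - s - neckSlope n s / neckSlopeDeriv n s)
      (f' := fun s => -(((n : ℝ) + 1) / (1 + neckSlope n s ^ (n + 1))))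
      (fun r hr => ?_) (fun r hr => ?_) ?_ hs
    · have hw := neckSlope_pos hn hr
      have hg := neckSlopeDeriv_pos hn hr
      have h := ((hasDerivAt_id r).const_sub 1).sub
        ((neckSlope_hasDerivAt hn hr).div (neckSlopeDeriv_hasDerivAt hn hr) hg.ne')
      refine h.congr_deriv ?_
      have h1 : (neckSlopeDeriv n r * neckSlopeDeriv n r - neckSlope n r * (neckSlopeDeriv n r *
          (neckRate n * (2 * neckSlope n r - ((n : ℝ) - 1) / neckSlope n r ^ n)))) /
          neckSlopeDeriv n r ^ 2 = 1 - neckSlope n r *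
          (neckRate n * (2 * neckSlope n r - ((n : ℝ) - 1) / neckSlope n r ^ n)) /
          neckSlopeDeriv n r := by
        field_simp
      rw [h1, neckSlopeDeriv]
      obtain ⟨m, rfl⟩ := Nat.exists_eq_add_of_le' hn
      simp only [Nat.add_sub_cancel]
      push_cast
      field_simp
      ring
    · have hw := neckSlope_pos hn hr
      exact neg_neg_of_pos (by positivity)
    · have hlim : Tendsto (fun s => neckSlope n s / neckSlopeDeriv n s) (𝓝[<] 1) (𝓝 0) := by
        have hI : ∀ᶠ s : ℝ in 𝓝[<] 1, s ∈ Ioo (0 : ℝ) 1 := Ioo_mem_nhdsLT one_pos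
        have h0 : Tendsto (fun s => (neckRate n)⁻¹ * (neckSlope n s)⁻¹) (𝓝[<] 1) (𝓝 0) := by
          simpa using (neckSlope_tendsto_atTop hn).inv_tendsto_atTop.const_mul (neckRate n)⁻¹
        refine tendsto_of_tendsto_of_tendsto_of_le_of_le' tendsto_const_nhds h0 ?_ ?_
        · filter_upwards [hI] with r hr
          exact (div_pos (neckSlope_pos hn hr) (neckSlopeDeriv_pos hn hr)).le
        · filter_upwards [hI] with r hr
          have hw := neckSlope_pos hn hr
          have hg := neckSlopeDeriv_pos hn hr
          rw [div_le_iff₀ hg, neckSlopeDeriv]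
          obtain ⟨m, rfl⟩ := Nat.exists_eq_add_of_le' hn
          simp only [Nat.add_sub_cancel]
          field_simp
          rw [← pow_add]
          ring_nf
          linarith
      simpa using one_sub_tendsto_zero.sub hlim
  have hg := neckSlopeDeriv_pos hn hs
  have : neckSlope n s < neckSlopeDeriv n s * (1 - s) := by
    rw [sub_pos, div_lt_iff₀ hg] at hpos
    linarith
  exact neg_neg_of_pos (mul_pos hk (sub_pos.2 this))

theorem neckDecaying_strictAntiOn (hn : 1 ≤ n) : StrictAntiOn (neckDecaying n) (Ioo 0 1) := by
  refine strictAntiOn_of_deriv_neg (convex_Ioo 0 1)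
    (fun r hr => (neckDecaying_hasDerivAt hn hr).continuousAt.continuousWithinAt) ?_
  rw [interior_Ioo]
  intro s hs
  rw [(neckDecaying_hasDerivAt hn hs).deriv]
  exact neckDecayingDeriv_neg hn hs

/-! ### Solutions bounded near `1` -/

/-- A solution that is bounded near `1` is a multiple of the decaying one. -/
theorem IsNeckSolution.eq_const_mul_of_isBigO (hn : 1 ≤ n) {u : ℝ → ℝ} (hu : IsNeckSolution n u)
    (hb : u =O[𝓝[<] 1] fun _ => (1 : ℝ)) :
    ∃ c : ℝ, ∀ s ∈ Ioo (0 : ℝ) 1, u s = c * neckDecaying n s := by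
  obtain ⟨a, c, h⟩ := hu.exists_eq_combination hn
  suffices ha : a = 0 from ⟨c, fun s hs => by rw [h s hs, ha, zero_mul, zero_add]⟩
  by_contra ha
  have hI : ∀ᶠ s : ℝ in 𝓝[<] 1, s ∈ Ioo (0 : ℝ) 1 := Ioo_mem_nhdsLT one_pos
  have hd : (fun s => c * neckDecaying n s) =O[𝓝[<] 1] fun _ => (1 : ℝ) :=
    ((neckDecaying_tendsto_zero hn).const_mul c).isBigO_one ℝ
  have hw : (fun s => a * neckSlope n s) =O[𝓝[<] 1] fun _ => (1 : ℝ) :=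
    (hb.sub hd).congr' (hI.mono fun s hs => by simp [h s hs]) EventuallyEq.rfl
  have hw' : neckSlope n =O[𝓝[<] 1] fun _ => (1 : ℝ) := (isBigO_const_mul_left_iff ha).1 hw
  exact not_isBoundedUnder_of_tendsto_atTop
    (tendsto_norm_atTop_atTop.comp (neckSlope_tendsto_atTop hn)) ((isBigO_one_iff ℝ).1 hw')

/-- The leading term `(c(n) n s / (n+1))^(1/n)` of `neckSlope n s` as `s → 0`. -/
def neckLeading (n : ℕ) (s : ℝ) : ℝ := (n * neckRate n * s) ^ (1 / (n : ℝ))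

/-! ### Expansion of the decaying solution near `0` -/

theorem neckLeading_pos (hn : 1 ≤ n) (hs : 0 < s) : 0 < neckLeading n s := by
  have := neckRate_pos hn
  have : 0 < (n : ℝ) := by exact_mod_cast hn
  exact Real.rpow_pos_of_pos (by positivity) _

theorem neckLeading_pow (hn : 1 ≤ n) (hs : 0 < s) :
    neckLeading n s ^ n = n * neckRate n * s := by
  have := neckRate_pos hn
  rw [neckLeading, one_div, Real.rpow_inv_natCast_pow (by positivity) (by omega)]

theorem neckLeading_eq (hn : 1 ≤ n) (hs : 0 < s) :
    neckLeading n s = (n * neckRate n) ^ (1 / (n : ℝ)) * s ^ (1 / (n : ℝ)) := by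
  have := neckRate_pos hn
  rw [neckLeading, Real.mul_rpow (by positivity) hs.le]

theorem neckLeading_hasDerivAt (hn : 1 ≤ n) (hs : 0 < s) :
    HasDerivAt (neckLeading n) (neckLeading n s / (n * s)) s := by
  have hk := neckRate_pos hn
  have hn0 : 0 < (n : ℝ) := by exact_mod_cast hn
  have hp : 0 < n * neckRate n * s := by positivity
  have h := ((hasDerivAt_id s).const_mul (n * neckRate n)).rpow_const (p := 1 / (n : ℝ))
    (Or.inl (by simpa using hp.ne'))
  refine h.congr_deriv ?_
  simp only [id]
  rw [Real.rpow_sub hp, Real.rpow_one, ← neckLeading]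
  field_simp

/-- Raising to the power `n` removes the singularity at `0`: `(w^n)' = nκ (1 + w^(n+1))`. -/
theorem neckSlope_pow_gap_hasDerivAt (hn : 1 ≤ n) (hs : s ∈ Ioo (0 : ℝ) 1) :
    HasDerivAt (fun s => neckSlope n s ^ n - n * neckRate n * s)
      (n * neckRate n * neckSlope n s ^ (n + 1)) s := by
  have hw := neckSlope_pos hn hs
  have h := ((neckSlope_hasDerivAt hn hs).pow n).sub
    ((hasDerivAt_id s).const_mul (n * neckRate n))
  refine h.congr_deriv ?_
  rw [neckSlopeDeriv]
  field_simp
  ring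

theorem neckSlope_pow_gap_tendsto (hn : 1 ≤ n) :
    Tendsto (fun s => neckSlope n s ^ n - n * neckRate n * s) (𝓝[>] 0) (𝓝 0) := by
  have h : Tendsto (fun s : ℝ => s) (𝓝[>] 0) (𝓝 0) := tendsto_id.mono_left nhdsWithin_le_nhds
  simpa [zero_pow (show n ≠ 0 by omega)] using
    ((neckSlope_tendsto_zero hn).pow n).sub (h.const_mul (n * neckRate n))

theorem neckLeading_lt_neckSlope (hn : 1 ≤ n) (hs : s ∈ Ioo (0 : ℝ) 1) :
    neckLeading n s < neckSlope n s := by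
  have hk := neckRate_pos hn
  have hn0 : 0 < (n : ℝ) := by exact_mod_cast hn
  have h := pos_of_hasDerivAt_pos_of_tendsto_left
    (f := fun s => neckSlope n s ^ n - n * neckRate n * s)
    (fun _ hr => neckSlope_pow_gap_hasDerivAt hn hr)
    (fun r hr => by have := neckSlope_pos hn hr; positivity) (neckSlope_pow_gap_tendsto hn) hs
  refine lt_of_pow_lt_pow_left₀ n (neckSlope_pos hn hs).le ?_
  rw [neckLeading_pow hn hs.1]
  linarith

/-- The left side is the integral of `nκ w^(n+1)` over `(0, s)`, whose integrand is increasing, and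
`nκs = b^n`. -/
theorem neckSlope_pow_sub_lt (hn : 1 ≤ n) (hs : s ∈ Ioo (0 : ℝ) 1) :
    neckSlope n s ^ n - neckLeading n s ^ n < neckLeading n s ^ n * neckSlope n s ^ (n + 1) := by
  have hk := neckRate_pos hn
  have hn0 : 0 < (n : ℝ) := by exact_mod_cast hn
  rw [neckLeading_pow hn hs.1, ← sub_pos]
  refine pos_of_hasDerivAt_pos_of_tendsto_left
    (f := fun s => n * neckRate n * s * neckSlope n s ^ (n + 1) -
      (neckSlope n s ^ n - n * neckRate n * s))
    (f' := fun s => n * neckRate n * s * ((n + 1) * neckSlope n s ^ n * neckSlopeDeriv n s))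
    (fun r hr => ?_) (fun r hr => ?_) ?_ hs
  · have h := (((hasDerivAt_id r).const_mul (n * neckRate n)).mul
      ((neckSlope_hasDerivAt hn hr).pow (n + 1))).sub (neckSlope_pow_gap_hasDerivAt hn hr)
    refine h.congr_deriv ?_
    simp only [Nat.add_sub_cancel, id, Pi.pow_apply]
    push_cast
    ring
  · have := neckSlope_pos hn hr
    have := neckSlopeDeriv_pos hn hr
    have := hr.1
    positivity
  · have h : Tendsto (fun s : ℝ => s) (𝓝[>] 0) (𝓝 0) := tendsto_id.mono_left nhdsWithin_le_nhds
    simpa using ((h.const_mul (n * neckRate n)).mul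
      ((neckSlope_tendsto_zero hn).pow (n + 1))).sub (neckSlope_pow_gap_tendsto hn)

/-- The relative error `1 - (neckLeading / neckSlope)^n`. -/
def neckRelGap (n : ℕ) (s : ℝ) : ℝ := 1 - (neckLeading n s / neckSlope n s) ^ n

theorem neckRelGap_mem (hn : 1 ≤ n) (hs : s ∈ Ioo (0 : ℝ) 1) :
    neckRelGap n s ∈ Icc 0 (neckSlope n s ^ (n + 1)) := by
  have hw := neckSlope_pos hn hs
  have hb := neckLeading_pos hn hs.1
  have hlt := neckLeading_lt_neckSlope hn hs
  have hle : neckLeading n s / neckSlope n s ≤ 1 := (div_le_one hw).2 hlt.le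
  refine ⟨sub_nonneg.2 (pow_le_one₀ (by positivity) hle), ?_⟩
  have h1 := neckSlope_pow_sub_lt hn hs
  have h2 : neckLeading n s ^ n * neckSlope n s ^ (n + 1) ≤
      neckSlope n s ^ n * neckSlope n s ^ (n + 1) := by gcongr
  have hwn := pow_pos hw n
  rw [neckRelGap, div_pow, one_sub_div hwn.ne', div_le_iff₀ hwn]
  linarith

/-- Because `b/w ≤ 1`, one has `(b/w)^n ≤ b/w`; this avoids taking `n`-th roots. -/
theorem neckSlope_sub_neckLeading_le (hn : 1 ≤ n) (hs : s ∈ Ioo (0 : ℝ) 1) :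
    neckSlope n s - neckLeading n s ≤ neckSlope n s * neckRelGap n s := by
  have hw := neckSlope_pos hn hs
  have hb := neckLeading_pos hn hs.1
  have hle : neckLeading n s / neckSlope n s ≤ 1 :=
    (div_le_one hw).2 (neckLeading_lt_neckSlope hn hs).le
  have h := pow_le_of_le_one (by positivity) hle (show n ≠ 0 by omega)
  have h2 := mul_le_mul_of_nonneg_left h hw.le
  rw [mul_div_cancel₀ _ hw.ne'] at h2
  rw [neckRelGap]
  linarith

/-! ### The error `w - b` and its derivatives, all bounded by powers of `w` -/

/-- The error term `neckSlope - neckLeading`. -/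
def neckError (n : ℕ) (s : ℝ) : ℝ := neckSlope n s - neckLeading n s

/-- The derivative of `neckError`. -/
def neckErrorDeriv (n : ℕ) (s : ℝ) : ℝ := neckSlopeDeriv n s - neckLeading n s / (n * s)

/-- The second derivative of `neckError`. -/
def neckErrorDeriv₂ (n : ℕ) (s : ℝ) : ℝ :=
  neckSlopeDeriv n s * (neckRate n * (2 * neckSlope n s - ((n : ℝ) - 1) / neckSlope n s ^ n)) +
    ((n : ℝ) - 1) * neckLeading n s / (n * s) ^ 2

theorem neckError_hasDerivAt (hn : 1 ≤ n) (hs : s ∈ Ioo (0 : ℝ) 1) :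
    HasDerivAt (neckError n) (neckErrorDeriv n s) s :=
  (neckSlope_hasDerivAt hn hs).sub (neckLeading_hasDerivAt hn hs.1)

theorem neckErrorDeriv_hasDerivAt (hn : 1 ≤ n) (hs : s ∈ Ioo (0 : ℝ) 1) :
    HasDerivAt (neckErrorDeriv n) (neckErrorDeriv₂ n s) s := by
  have hn0 : 0 < (n : ℝ) := by exact_mod_cast hn
  have hs0 := hs.1
  have h := (neckSlopeDeriv_hasDerivAt hn hs).sub ((neckLeading_hasDerivAt hn hs.1).div
    ((hasDerivAt_id s).const_mul (n : ℝ)) (by simpa using (mul_pos hn0 hs0).ne'))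
  refine h.congr_deriv ?_
  simp only [neckErrorDeriv₂, id]
  field_simp
  ring

theorem neckErrorDeriv₂_continuousOn (hn : 1 ≤ n) :
    ContinuousOn (neckErrorDeriv₂ n) (Ioo 0 1) := by
  have hn0 : 0 < (n : ℝ) := by exact_mod_cast hn
  refine (neckSlopeDeriv_deriv_continuousOn hn).add (ContinuousOn.div ?_ (by fun_prop) ?_)
  · exact continuousOn_const.mul fun s hs =>
      (neckLeading_hasDerivAt hn hs.1).continuousAt.continuousWithinAt
  · intro s hs
    have := hs.1
    positivity

theorem abs_neckError_le (hn : 1 ≤ n) (hs : s ∈ Ioo (0 : ℝ) 1) :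
    |neckError n s| ≤ neckSlope n s ^ (n + 2) := by
  have hw := neckSlope_pos hn hs
  rw [neckError, abs_of_pos (sub_pos.2 (neckLeading_lt_neckSlope hn hs))]
  calc _ ≤ neckSlope n s * neckRelGap n s := neckSlope_sub_neckLeading_le hn hs
    _ ≤ neckSlope n s * neckSlope n s ^ (n + 1) := by gcongr; exact (neckRelGap_mem hn hs).2
    _ = _ := by ring

/-- Since `nκs = b^n`, multiplying `w'` by `ns` gives `w (b/w)^n + b^n w^2`. -/
theorem mul_neckSlopeDeriv (hn : 1 ≤ n) (hs : s ∈ Ioo (0 : ℝ) 1) :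
    n * (s * neckSlopeDeriv n s) = neckSlope n s - neckSlope n s * neckRelGap n s +
      neckLeading n s ^ n * neckSlope n s ^ 2 := by
  have hw := neckSlope_pos hn hs
  have h := neckLeading_pow hn hs.1
  rw [neckRelGap, div_pow, h, neckSlopeDeriv]
  obtain ⟨m, rfl⟩ := Nat.exists_eq_add_of_le' hn
  simp only [Nat.add_sub_cancel]
  field_simp
  ring

theorem mul_neckErrorDeriv (hn : 1 ≤ n) (hs : s ∈ Ioo (0 : ℝ) 1) :
    n * (s * neckErrorDeriv n s) = neckError n s - neckSlope n s * neckRelGap n s +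
      neckLeading n s ^ n * neckSlope n s ^ 2 := by
  have hn0 : 0 < (n : ℝ) := by exact_mod_cast hn
  have hs0 := hs.1
  have h : n * (s * neckErrorDeriv n s) = n * (s * neckSlopeDeriv n s) - neckLeading n s := by
    rw [neckErrorDeriv]; field_simp
  rw [h, mul_neckSlopeDeriv hn hs, neckError]
  ring

theorem neckLeading_pow_mul_le (hn : 1 ≤ n) (hs : s ∈ Ioo (0 : ℝ) 1) (m : ℕ) :
    neckLeading n s ^ n * neckSlope n s ^ m ≤ neckSlope n s ^ (n + m) := by
  have hw := neckSlope_pos hn hs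
  have hb := neckLeading_pos hn hs.1
  rw [pow_add]
  gcongr
  exact (neckLeading_lt_neckSlope hn hs).le

theorem abs_mul_neckErrorDeriv_le (hn : 1 ≤ n) (hs : s ∈ Ioo (0 : ℝ) 1) :
    |n * (s * neckErrorDeriv n s)| ≤ neckSlope n s ^ (n + 2) := by
  have hw := neckSlope_pos hn hs
  have hb := neckLeading_pos hn hs.1
  have hE : 0 < neckError n s := sub_pos.2 (neckLeading_lt_neckSlope hn hs)
  have h1 : neckError n s ≤ neckSlope n s * neckRelGap n s := neckSlope_sub_neckLeading_le hn hs
  have h2 : neckSlope n s * neckRelGap n s ≤ neckSlope n s * neckSlope n s ^ (n + 1) := by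
    gcongr; exact (neckRelGap_mem hn hs).2
  have h3 : neckSlope n s * neckSlope n s ^ (n + 1) = neckSlope n s ^ (n + 2) := by ring
  have h4 := neckLeading_pow_mul_le hn hs 2
  have h5 : 0 < neckLeading n s ^ n * neckSlope n s ^ 2 := by positivity
  -- The difference of the first two terms lies in `[-w^(n+2), 0]` and the last term in `[0,
  -- w^(n+2)]`; the opposite signs keep the constant equal to `1`.
  rw [mul_neckErrorDeriv hn hs, abs_le]
  constructor <;> linarith

theorem abs_mul_neckErrorDeriv₂_le (hn : 1 ≤ n) (hs : s ∈ Ioo (0 : ℝ) 1)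
    (h1 : neckSlope n s ≤ 1) :
    |(n : ℝ) ^ 2 * (s ^ 2 * neckErrorDeriv₂ n s)| ≤ (3 * n + 1) * neckSlope n s ^ (n + 2) := by
  have hw := neckSlope_pos hn hs
  have hb := neckLeading_pos hn hs.1
  have hn1 : 1 ≤ (n : ℝ) := by exact_mod_cast hn
  have hs0 := hs.1
  -- `Y - (n-1)` is `ns w''/w'`. As `n²s² b'' = -(n-1) b`, the leading parts cancel and each term
  -- left in `hkey` contains a small factor, `Y` or `ns` times `neckErrorDeriv`.
  set Y := ((n : ℝ) - 1) * neckRelGap n s + 2 * (neckLeading n s ^ n * neckSlope n s) with hY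
  have hkey : (n : ℝ) ^ 2 * (s ^ 2 * neckErrorDeriv₂ n s) = neckLeading n s * Y +
      n * (s * neckErrorDeriv n s) * (Y - (n - 1)) := by
    have h := neckLeading_pow hn hs.1
    rw [hY, neckRelGap, div_pow, h, neckErrorDeriv, neckErrorDeriv₂]
    field_simp
    ring
  obtain ⟨hZ0, hZ1⟩ := neckRelGap_mem hn hs
  have hY0 : 0 ≤ Y := by
    have : 0 ≤ (n : ℝ) - 1 := by linarith
    positivity
  have hY1 : Y ≤ (n + 1) * neckSlope n s ^ (n + 1) := by
    have h2 := neckLeading_pow_mul_le hn hs 1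
    rw [pow_one] at h2
    have := mul_le_mul_of_nonneg_left hZ1 (show 0 ≤ (n : ℝ) - 1 by linarith)
    linarith
  have hp : neckSlope n s ^ (n + 1) ≤ 1 := pow_le_one₀ hw.le h1
  have hX : |Y - (n - 1)| ≤ 2 * n := by
    have : Y ≤ n + 1 := hY1.trans (mul_le_of_le_one_right (by positivity) hp)
    rw [abs_le]; constructor <;> linarith
  rw [hkey]
  calc _ ≤ |neckLeading n s * Y| + |n * (s * neckErrorDeriv n s) * (Y - (n - 1))| := abs_add_le _ _
    _ ≤ neckSlope n s * ((n + 1) * neckSlope n s ^ (n + 1)) +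
        neckSlope n s ^ (n + 2) * (2 * n) := by
      refine add_le_add ?_ ?_
      · rw [abs_of_nonneg (by positivity)]
        gcongr
        exact (neckLeading_lt_neckSlope hn hs).le
      · rw [abs_mul]
        gcongr
        exact abs_mul_neckErrorDeriv_le hn hs
    _ = _ := by ring

/-- Here `w^n ≤ 2 b^n ≤ (2b)^n`. This turns bounds in powers of `w` into powers of `s`. -/
theorem neckSlope_le_two_mul_neckLeading (hn : 1 ≤ n) (hs : s ∈ Ioo (0 : ℝ) 1)
    (h1 : neckSlope n s ≤ 1) : neckSlope n s ≤ 2 * neckLeading n s := by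
  have hw := neckSlope_pos hn hs
  have hb := neckLeading_pos hn hs.1
  have h := neckSlope_pow_sub_lt hn hs
  have h2 : neckLeading n s ^ n * neckSlope n s ^ (n + 1) ≤ neckLeading n s ^ n :=
    mul_le_of_le_one_right (by positivity) (pow_le_one₀ hw.le h1)
  refine le_of_pow_le_pow_left₀ (show n ≠ 0 by omega) (by positivity) ?_
  have h3 : (2 : ℝ) * neckLeading n s ^ n ≤ 2 ^ n * neckLeading n s ^ n := by
    gcongr
    exact le_self_pow₀ (by norm_num) (by omega)
  rw [mul_pow]
  linarith

theorem neckSlope_pow_isBigO (hn : 1 ≤ n) :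
    (fun s => neckSlope n s ^ (n + 2)) =O[𝓝[>] 0] fun s : ℝ => s ^ (((n : ℝ) + 2) / n) := by
  have hk := neckRate_pos hn
  have hn0 : 0 < (n : ℝ) := by exact_mod_cast hn
  have hI : ∀ᶠ s : ℝ in 𝓝[>] 0, s ∈ Ioo (0 : ℝ) 1 := Ioo_mem_nhdsGT one_pos
  refine IsBigO.of_bound ((2 * (n * neckRate n) ^ (1 / (n : ℝ))) ^ (n + 2)) ?_
  filter_upwards [hI, (neckSlope_tendsto_zero hn).eventually_le_const one_pos] with s hs h1
  have hw := neckSlope_pos hn hs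
  have hs0 := hs.1
  have hr : s ^ (((n : ℝ) + 2) / n) = (s ^ (1 / (n : ℝ))) ^ (n + 2) := by
    rw [← Real.rpow_natCast, ← Real.rpow_mul hs0.le]
    push_cast
    ring_nf
  rw [Real.norm_of_nonneg (by positivity), Real.norm_of_nonneg (by positivity), hr, ← mul_pow,
    mul_assoc, ← neckLeading_eq hn hs0]
  gcongr
  exact neckSlope_le_two_mul_neckLeading hn hs h1

/-! ### The remainder in (3) -/

/-- The remainder in the expansion of `neckDecaying` at `0`. -/
def neckRemainder (n : ℕ) (s : ℝ) : ℝ := -(neckRate n * (neckError n s * (1 - s)))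

/-- Replacing `w` by `b` plus the error in `1 - κ w (1-s)`, the two terms of `κ b (1-s)` carry the
same coefficient, so `C₁ = C₂`. -/
theorem neckDecaying_eq_expansion (hn : 1 ≤ n) (hs : s ∈ Ioo (0 : ℝ) 1) :
    neckDecaying n s = 1 - neckRate n * (n * neckRate n) ^ (1 / (n : ℝ)) * s ^ (1 / (n : ℝ)) +
      neckRate n * (n * neckRate n) ^ (1 / (n : ℝ)) * s ^ (((n : ℝ) + 1) / n) +
      neckRemainder n s := by
  have hn0 : (n : ℝ) ≠ 0 := by exact_mod_cast (show n ≠ 0 by omega)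
  have hp : s ^ (((n : ℝ) + 1) / n) = s * s ^ (1 / (n : ℝ)) := by
    rw [add_div, div_self hn0, Real.rpow_add hs.1, Real.rpow_one]
  rw [neckDecaying, neckRemainder, neckError, neckLeading_eq hn hs.1, hp]
  ring

theorem neckRemainder_hasDerivAt (hn : 1 ≤ n) (hs : s ∈ Ioo (0 : ℝ) 1) :
    HasDerivAt (neckRemainder n)
      (-(neckRate n * (neckErrorDeriv n s * (1 - s) - neckError n s))) s := by
  have h := (((neckError_hasDerivAt hn hs).mul ((hasDerivAt_id s).const_sub 1)).const_mul
    (neckRate n)).neg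
  refine h.congr_deriv ?_
  simp only [id]
  ring

theorem neckRemainder_deriv_hasDerivAt (hn : 1 ≤ n) (hs : s ∈ Ioo (0 : ℝ) 1) :
    HasDerivAt (fun s => -(neckRate n * (neckErrorDeriv n s * (1 - s) - neckError n s)))
      (-(neckRate n * (neckErrorDeriv₂ n s * (1 - s) - 2 * neckErrorDeriv n s))) s := by
  have h := ((((neckErrorDeriv_hasDerivAt hn hs).mul ((hasDerivAt_id s).const_sub 1)).sub
    (neckError_hasDerivAt hn hs)).const_mul (neckRate n)).neg
  refine h.congr_deriv ?_
  simp only [id]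
  ring

theorem neckRemainder_contDiffOn (hn : 1 ≤ n) : ContDiffOn ℝ 2 (neckRemainder n) (Ioo 0 1) := by
  refine contDiffOn_two_of_hasDerivAt isOpen_Ioo (fun s hs => neckRemainder_hasDerivAt hn hs)
    (fun s hs => neckRemainder_deriv_hasDerivAt hn hs) ?_
  exact (continuousOn_const.mul (((neckErrorDeriv₂_continuousOn hn).mul
    (continuousOn_const.sub continuousOn_id)).sub (continuousOn_const.mul fun s hs =>
      (neckErrorDeriv_hasDerivAt hn hs).continuousAt.continuousWithinAt))).neg

theorem neckRemainder_isBigO (hn : 1 ≤ n) :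
    (fun s : ℝ => |neckRemainder n s| + s * |deriv (neckRemainder n) s| +
      s ^ 2 * |deriv (deriv (neckRemainder n)) s|) =O[𝓝[>] 0]
      fun s : ℝ => s ^ (((n : ℝ) + 2) / n) := by
  have hk := neckRate_pos hn
  have hn1 : 1 ≤ (n : ℝ) := by exact_mod_cast hn
  have hI : ∀ᶠ s : ℝ in 𝓝[>] 0, s ∈ Ioo (0 : ℝ) 1 := Ioo_mem_nhdsGT one_pos
  -- `3n + 6 = 1 + 1 + 1 + (3n + 1) + 2`, one summand for each error term in the final sum.
  refine IsBigO.trans (IsBigO.of_bound (neckRate n * (3 * n + 6)) ?_) (neckSlope_pow_isBigO hn)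
  filter_upwards [hI, (neckSlope_tendsto_zero hn).eventually_le_const one_pos] with s hs h1
  have hw := neckSlope_pos hn hs
  have hs0 := hs.1
  have ht0 : 0 ≤ 1 - s := by linarith [hs.2]
  have ht1 : 1 - s ≤ 1 := by linarith
  have hE := abs_neckError_le hn hs
  have hE1 : s * |neckErrorDeriv n s| ≤ neckSlope n s ^ (n + 2) := by
    have h := abs_mul_neckErrorDeriv_le hn hs
    rw [abs_mul, abs_mul, abs_of_pos hs0, abs_of_pos (by linarith : (0 : ℝ) < n)] at h
    exact (le_mul_of_one_le_left (by positivity) hn1).trans h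
  have hE2 : s ^ 2 * |neckErrorDeriv₂ n s| ≤ (3 * n + 1) * neckSlope n s ^ (n + 2) := by
    have h := abs_mul_neckErrorDeriv₂_le hn hs h1
    rw [abs_mul, abs_mul, abs_of_pos (by positivity : 0 < s ^ 2),
      abs_of_pos (by positivity : (0 : ℝ) < (n : ℝ) ^ 2)] at h
    exact (le_mul_of_one_le_left (by positivity) (one_le_pow₀ hn1)).trans h
  have hR : |neckRemainder n s| ≤ neckRate n * |neckError n s| := by
    rw [neckRemainder, abs_neg, abs_mul, abs_mul, abs_of_pos hk, abs_of_nonneg ht0]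
    gcongr
    exact mul_le_of_le_one_right (abs_nonneg _) ht1
  have hR1 : |deriv (neckRemainder n) s| ≤
      neckRate n * (|neckErrorDeriv n s| + |neckError n s|) := by
    rw [(neckRemainder_hasDerivAt hn hs).deriv, abs_neg, abs_mul, abs_of_pos hk]
    gcongr
    refine (abs_sub _ _).trans ?_
    rw [abs_mul, abs_of_nonneg ht0]
    gcongr
    exact mul_le_of_le_one_right (abs_nonneg _) ht1
  have hR2 : |deriv (deriv (neckRemainder n)) s| ≤
      neckRate n * (|neckErrorDeriv₂ n s| + 2 * |neckErrorDeriv n s|) := by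
    rw [deriv_deriv_of_hasDerivAt isOpen_Ioo (fun r hr => neckRemainder_hasDerivAt hn hr) hs
      (neckRemainder_deriv_hasDerivAt hn hs), abs_neg, abs_mul, abs_of_pos hk]
    gcongr
    refine (abs_sub _ _).trans ?_
    rw [abs_mul, abs_mul, abs_of_nonneg ht0, abs_two]
    gcongr
    exact mul_le_of_le_one_right (abs_nonneg _) ht1
  rw [Real.norm_of_nonneg (by positivity), Real.norm_of_nonneg (by positivity)]
  have hsE : s * |neckError n s| ≤ |neckError n s| :=
    mul_le_of_le_one_left (abs_nonneg _) hs.2.le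
  have hsE1 : s * (s * |neckErrorDeriv n s|) ≤ s * |neckErrorDeriv n s| :=
    mul_le_of_le_one_left (by positivity) hs.2.le
  calc _ ≤ neckRate n * |neckError n s| +
        s * (neckRate n * (|neckErrorDeriv n s| + |neckError n s|)) +
        s ^ 2 * (neckRate n * (|neckErrorDeriv₂ n s| + 2 * |neckErrorDeriv n s|)) := by gcongr
    _ = neckRate n * (|neckError n s| + s * |neckErrorDeriv n s| + s * |neckError n s| +
        s ^ 2 * |neckErrorDeriv₂ n s| + 2 * (s * (s * |neckErrorDeriv n s|))) := by ring
    _ ≤ neckRate n * ((3 * n + 6) * neckSlope n s ^ (n + 2)) := by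
        gcongr
        linarith
    _ = _ := by ring

end Neck

end

theorem mainTheorem7 (n : ℕ) (hn : 1 ≤ n) :
    ∃ uhat : ℝ → ℝ,
      -- existence
      (IsNeckSolution n uhat ∧ Tendsto uhat (𝓝[>] 0) (𝓝 1) ∧ Tendsto uhat (𝓝[<] 1) (𝓝 0)) ∧
      -- uniqueness
      (∀ u : ℝ → ℝ, IsNeckSolution n u → Tendsto u (𝓝[>] 0) (𝓝 1) →
        Tendsto u (𝓝[<] 1) (𝓝 0) → EqOn u uhat (Ioo 0 1)) ∧
      -- (1)
      StrictAntiOn uhat (Ioo 0 1) ∧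
      -- (2)
      ((fun η : ℝ => uhat (1 - η)) =O[𝓝[>] 0] fun η : ℝ => η ^ (n + 1)) ∧
      -- (3)
      (∃ C₁ C₂ : ℝ, 0 < C₁ ∧ 0 < C₂ ∧ ∃ R : ℝ → ℝ,
        (∀ s ∈ Ioo (0 : ℝ) 1, uhat s =
          1 - C₁ * s ^ (1 / (n : ℝ)) + C₂ * s ^ (((n : ℝ) + 1) / n) + R s) ∧
        ContDiffOn ℝ 2 R (Ioo 0 1) ∧
        ((fun s : ℝ => |R s| + s * |deriv R s| + s ^ 2 * |deriv (deriv R) s|)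
          =O[𝓝[>] 0] fun s : ℝ => s ^ (((n : ℝ) + 2) / n))) ∧
      -- (4)
      (∀ (u : ℝ → ℝ) (δ C : ℝ), IsNeckSolution n u → δ ∈ Ioo (0 : ℝ) 1 →
        (∀ s ∈ Ioo (0 : ℝ) 1, |u s| ≤ C * s ^ (-δ)) →
        ∃ c : ℝ, ∀ s ∈ Ioo (0 : ℝ) 1, u s = c * uhat s) := by
  have hk := neckRate_pos hn
  have hn0 : 0 < (n : ℝ) := by exact_mod_cast hn
  have hC : 0 < neckRate n * (n * neckRate n) ^ (1 / (n : ℝ)) := by positivity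
  refine ⟨neckDecaying n, ⟨neckDecaying_isNeckSolution hn, neckDecaying_tendsto_one hn,
    neckDecaying_tendsto_zero hn⟩, fun u hu h0 h1 => ?_, neckDecaying_strictAntiOn hn, ?_,
    ⟨_, _, hC, hC, neckRemainder n, fun s hs => neckDecaying_eq_expansion hn hs,
      neckRemainder_contDiffOn hn, neckRemainder_isBigO hn⟩, fun u δ C hu _ hb => ?_⟩
  -- The limit at `1` makes `u` a multiple of `neckDecaying`; the limit at `0` fixes the factor.
  · obtain ⟨c, hc⟩ := hu.eq_const_mul_of_isBigO hn (h1.isBigO_one ℝ)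
    have hI : ∀ᶠ s : ℝ in 𝓝[>] 0, s ∈ Ioo (0 : ℝ) 1 := Ioo_mem_nhdsGT one_pos
    have hlim : Tendsto u (𝓝[>] 0) (𝓝 (c * 1)) :=
      ((neckDecaying_tendsto_one hn).const_mul c).congr' (hI.mono fun s hs => (hc s hs).symm)
    have hc1 : c = 1 := by simpa using tendsto_nhds_unique hlim h0
    intro s hs
    rw [hc s hs, hc1, one_mul]
  · have ht : Tendsto (fun η : ℝ => 1 - η) (𝓝[>] 0) (𝓝[<] 1) := by
      refine tendsto_nhdsWithin_iff.2 ⟨?_, ?_⟩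
      · have h : Tendsto (fun η : ℝ => 1 - η) (𝓝 0) (𝓝 (1 - 0)) := tendsto_id.const_sub 1
        rw [sub_zero] at h
        exact h.mono_left nhdsWithin_le_nhds
      · filter_upwards [self_mem_nhdsWithin] with η hη
        exact sub_lt_self (1 : ℝ) hη
    simpa [Function.comp_def] using (neckDecaying_isBigO hn).comp_tendsto ht
  -- The majorant `C s^(-δ)` stays bounded as `s → 1`, which already rules out a `w` component.
  · refine hu.eq_const_mul_of_isBigO hn ?_
    have hI : ∀ᶠ s : ℝ in 𝓝[<] 1, s ∈ Ioo (0 : ℝ) 1 := Ioo_mem_nhdsLT one_pos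
    have hp : Tendsto (fun s : ℝ => C * s ^ (-δ)) (𝓝[<] 1) (𝓝 (C * 1 ^ (-δ))) :=
      ((tendsto_id.mono_left nhdsWithin_le_nhds).rpow_const (Or.inl one_ne_zero)).const_mul C
    refine IsBigO.trans (IsBigO.of_bound 1 ?_) (hp.isBigO_one ℝ)
    filter_upwards [hI] with s hs
    rw [one_mul]
    exact (hb s hs).trans (le_abs_self _)
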